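/- Let $\kappa_\infty>0$ and let $\kappa:\mathbb R\to\mathbb R$ be a domain wall function, i.e. $\kappa\in C^1(\mathbb R)$ is odd, $\kappa(x)=\kappa_\infty$ for $x\ge 1$ and $\kappa(x)=-\kappa_\infty$ for $x\le -1$. On $\mathcal H=L^2(\mathbb R;\mathbb C^2)$, for a bounded continuous real function $m$, let $\mathcal D_m=i\sigma_3\partial_x+m(x)\sigma_1$ with domain $H^1(\mathbb R;\mathbb C^2)$, where $\sigma_1=\begin{pmatrix}0&1\\1&0\end{pmatrix}$ and $\sigma_3=\begin{pmatrix}1&0\\0&-1\end{pmatrix}$. Let $$\alpha_\star(x)=\gamma\begin{pmatrix}1\\ i\end{pmatrix}e^{-\int_0^x\kappa(y)\,dy},\qquad \gamma=\frac1{\sqrt2\,\big\|e^{-\int_0^x\kappa(y)\,dy}\big\|_{L^2(\mathbb R)}},$$ be the normalized zero mode of $\mathcal D_\kappa$. For $\delta>1$ let $\kappa^\delta(x)=-\kappa(x+\delta)$ for $x\le 0$ and $\kappa^\delta(x)=\kappa(x-\delta)$ for $x\ge 0$, and put $\alpha_\star^{R,\delta}(x)=\alpha_\star(x-\delta)$ and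 $\alpha_\star^{L,\delta}(x)=\overline{\alpha_\star(x+\delta)}$ (componentwise complex conjugate). Assume the spectral gap condition: $\|\mathcal D_\kappa f\|_{\mathcal H}\ge\kappa_\infty\|f\|_{\mathcal H}$ for all $f\in H^1(\mathbb R;\mathbb C^2)$ with $\langle\alpha_\star,f\rangle_{\mathcal H}=0$. Let $0<K<\kappa_\infty$. Then there are constants $\delta_0\ge1$ and $C>0$, depending only on $\kappa$ and $K$, such that for every $\delta>\delta_0$ the operator $\mathcal D_{\kappa^\delta}$ has precisely two eigenvalues $E_+^\delta\ne E_-^\delta$ in $[-K,K]$, both are simple, and $$\Big|E^\delta_\pm\mp 2\gamma^2e^{-2\int_0^\delta\kappa(y)\,dy}\Big|\le C e^{-4\kappa_\infty\delta}.$$ Moreover there are eigenfunctions $\alpha_\pm^\delta$ for $E_\pm^\delta$, normalized by $\|\alpha^\delta_\pm\|_{\mathcal H}=1$, with $$\Big\|\alpha^\delta_\pm-\tfrac{1}{\sqrt2}\big(\alpha_\star^{R,\delta}\pm i\,\alpha_\star^{L,\delta}\big)\Big\|_{\mathcal H}\le C e^{-2\kappa_\infty\delta}.$$ -/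

import Mathlib

open MeasureTheory
open scoped ContDiff

noncomputable section

namespace DomainWall

/-- The values of the spinors: `ℂ²` with its Hermitian norm. -/
abbrev Spinor : Type := EuclideanSpace ℂ (Fin 2)

/-- The Hilbert space `L²(ℝ; ℂ²)`. -/
abbrev H : Type := Lp Spinor 2 (volume : Measure ℝ)

/-- The Pauli matrix `σ₁`. -/
def σ₁ : Matrix (Fin 2) (Fin 2) ℂ := !![0, 1; 1, 0]

/-- The Pauli matrix `σ₃`. -/
def σ₃ : Matrix (Fin 2) (Fin 2) ℂ := !![1, 0; 0, -1]

/-- `g` is the weak derivative of `f`, tested against smooth compactly supported functions.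
So `f : H` lies in the Sobolev space `H¹(ℝ; ℂ²)` when some `g : H` is its weak derivative. -/
def HasWeakDeriv (f g : H) : Prop :=
  ∀ φ : ℝ → ℝ, ContDiff ℝ ∞ φ → HasCompactSupport φ →
    ∫ x, deriv φ x • f x = -∫ x, φ x • g x

/-- The pointwise action of the symbol: `i σ₃ g(x) + κ(x) σ₁ f(x)`, where `g` stands for `f'`. -/
def diracExpr (κ : ℝ → ℝ) (f g : H) (x : ℝ) : Spinor :=
  Complex.I • Matrix.toLpLin 2 2 σ₃ (g x) + (κ x : ℂ) • Matrix.toLpLin 2 2 σ₁ (f x)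

lemma integrable_smul_of_test {φ : ℝ → ℝ} (hφ : Continuous φ) (hc : HasCompactSupport φ) (f : H) :
    Integrable (fun x => φ x • f x) := by
  have h := (Lp.memLp f).locallyIntegrable (by norm_num)
  exact h.integrable_smul_left_of_hasCompactSupport hφ hc

lemma HasWeakDeriv.zero : HasWeakDeriv 0 0 := by
  intro φ _ _
  have h : ∀ ψ : ℝ → ℝ, ∫ x, ψ x • (0 : H) x = 0 := by
    intro ψ
    simp
  rw [h, h, neg_zero]

lemma HasWeakDeriv.add {f g f' g' : H} (h : HasWeakDeriv f g) (h' : HasWeakDeriv f' g') :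
    HasWeakDeriv (f + f') (g + g') := by
  intro φ hφ hc
  have key : ∀ (ψ : ℝ → ℝ), Continuous ψ → HasCompactSupport ψ → ∀ u v : H,
      ∫ x, ψ x • (u + v) x = (∫ x, ψ x • u x) + ∫ x, ψ x • v x := by
    intro ψ hψ hψc u v
    rw [← integral_add (integrable_smul_of_test hψ hψc u) (integrable_smul_of_test hψ hψc v)]
    refine integral_congr_ae ?_
    filter_upwards [Lp.coeFn_add u v] with x hx
    rw [hx, Pi.add_apply, smul_add]
  have hd : Continuous (deriv φ) := hφ.continuous_deriv (by simp)
  rw [key _ hd hc.deriv, key _ hφ.continuous hc, h φ hφ hc, h' φ hφ hc]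
  abel

lemma HasWeakDeriv.smul {f g : H} (c : ℂ) (h : HasWeakDeriv f g) :
    HasWeakDeriv (c • f) (c • g) := by
  intro φ hφ hc
  have key : ∀ (ψ : ℝ → ℝ) (u : H), ∫ x, ψ x • (c • u) x = c • ∫ x, ψ x • u x := by
    intro ψ u
    rw [← integral_smul]
    refine integral_congr_ae ?_
    filter_upwards [Lp.coeFn_smul c u] with x hx
    rw [hx, Pi.smul_apply, smul_comm]
  rw [key, key, h φ hφ hc, smul_neg]

/-- Weak derivatives are unique. -/
lemma HasWeakDeriv.eq_zero {g : H} (h : HasWeakDeriv 0 g) : g = 0 := by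
  have hl := (Lp.memLp g).locallyIntegrable (by norm_num)
  have h0 : ∀ᵐ x, g x = 0 := by
    refine ae_eq_zero_of_integral_contDiff_smul_eq_zero hl ?_
    intro φ hφ hc
    have e := h φ hφ hc
    have z : ∫ x, deriv φ x • (0 : H) x = 0 := by simp
    rw [z] at e
    exact neg_eq_zero.mp e.symm
  exact (Lp.eq_zero_iff_ae_eq_zero).2 h0

/-- The graph of the Dirac operator `i σ₃ ∂ₓ + κ(x) σ₁`: all pairs `(f, h)` such that `f` lies in
`H¹(ℝ; ℂ²)` and `h = i σ₃ f' + κ σ₁ f` in `L²(ℝ; ℂ²)`. -/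
def diracGraph (κ : ℝ → ℝ) : Submodule ℂ (H × H) where
  carrier := {p | ∃ g : H, HasWeakDeriv p.1 g ∧ ∀ᵐ x, p.2 x = diracExpr κ p.1 g x}
  zero_mem' := by
    refine ⟨0, HasWeakDeriv.zero, ?_⟩
    filter_upwards with x
    simp [diracExpr]
  add_mem' := by
    rintro ⟨f, u⟩ ⟨f', u'⟩ ⟨g, hg, hu⟩ ⟨g', hg', hu'⟩
    refine ⟨g + g', hg.add hg', ?_⟩
    filter_upwards [hu, hu', Lp.coeFn_add f f', Lp.coeFn_add g g', Lp.coeFn_add u u']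
      with x h1 h2 h3 h4 h5
    simp only [diracExpr, Prod.mk_add_mk] at *
    rw [h5, h3, h4, Pi.add_apply, Pi.add_apply, Pi.add_apply, h1, h2]
    simp only [map_add, smul_add]
    abel
  smul_mem' := by
    rintro c ⟨f, u⟩ ⟨g, hg, hu⟩
    refine ⟨c • g, hg.smul c, ?_⟩
    filter_upwards [hu, Lp.coeFn_smul c f, Lp.coeFn_smul c g, Lp.coeFn_smul c u]
      with x h1 h3 h4 h5
    simp only [diracExpr, Prod.smul_mk] at *
    rw [h5, h3, h4, Pi.smul_apply, Pi.smul_apply, Pi.smul_apply, h1]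
    simp only [map_smul, smul_add, smul_comm c]

/-- The Dirac operator `D_κ = i σ₃ ∂ₓ + κ(x) σ₁` as an unbounded operator on `L²(ℝ; ℂ²)`. -/
def dirac (κ : ℝ → ℝ) : H →ₗ.[ℂ] H := (diracGraph κ).toLinearPMap

/-- The graph of `dirac κ` is the prescribed one. -/
lemma dirac_graph (κ : ℝ → ℝ) : (dirac κ).graph = diracGraph κ := by
  refine Submodule.toLinearPMap_graph_eq _ ?_
  rintro ⟨f, u⟩ ⟨g, hg, hu⟩ hf
  simp only at hf hg hu
  subst hf
  have hg0 : g = 0 := hg.eq_zero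
  subst hg0
  refine (Lp.eq_zero_iff_ae_eq_zero).2 ?_
  filter_upwards [hu] with x h1
  simp [h1, diracExpr]

/-- For a bounded measurable mass function, the domain of the Dirac operator is `H¹(ℝ; ℂ²)`. -/
lemma mem_dirac_domain_iff {κ : ℝ → ℝ} (hm : Measurable κ) {B : ℝ} (hB : ∀ x, |κ x| ≤ B) (f : H) :
    f ∈ (dirac κ).domain ↔ ∃ g : H, HasWeakDeriv f g := by
  have hdom : f ∈ (dirac κ).domain ↔ ∃ u : H, (f, u) ∈ diracGraph κ := by
    change f ∈ (diracGraph κ).map (LinearMap.fst ℂ H H) ↔ _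
    simp
  rw [hdom]
  constructor
  · rintro ⟨u, g, hg, -⟩
    exact ⟨g, hg⟩
  · rintro ⟨g, hg⟩
    have h1 : MemLp (fun x => Complex.I • Matrix.toLpLin 2 2 σ₃ (g x)) 2 volume :=
      ((LinearMap.toContinuousLinearMap (Matrix.toLpLin 2 2 σ₃)).comp_memLp' (Lp.memLp g)).const_smul
        Complex.I
    have h2 : MemLp (fun x => Matrix.toLpLin 2 2 σ₁ (f x)) 2 volume :=
      (LinearMap.toContinuousLinearMap (Matrix.toLpLin 2 2 σ₁)).comp_memLp' (Lp.memLp f)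
    have h3 : MemLp (fun x => (κ x : ℂ) • Matrix.toLpLin 2 2 σ₁ (f x)) 2 volume := by
      refine h2.of_le_mul (c := B) ?_ ?_
      · exact (Complex.measurable_ofReal.comp hm).aestronglyMeasurable.smul h2.1
      · filter_upwards with x
        rw [norm_smul, Complex.norm_real, Real.norm_eq_abs]
        exact mul_le_mul_of_nonneg_right (hB x) (norm_nonneg _)
    exact ⟨(h1.add h3).toLp _, g, hg, (h1.add h3).coeFn_toLp⟩

/-- The eigenspace of an unbounded operator `T` for the value `E`:
all `f` in the domain of `T` with `T f = E f`. -/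
def eigenspace (T : H →ₗ.[ℂ] H) (E : ℂ) : Submodule ℂ H :=
  T.graph.comap (LinearMap.prod LinearMap.id (E • LinearMap.id))

/-- The eigenfunctions of the Dirac operator are the `f` in `H¹(ℝ; ℂ²)` that satisfy the
eigenvalue equation `E f = i σ₃ f' + κ σ₁ f`. -/
lemma mem_eigenspace_dirac_iff (κ : ℝ → ℝ) (E : ℂ) (f : H) :
    f ∈ eigenspace (dirac κ) E ↔
      ∃ g : H, HasWeakDeriv f g ∧ ∀ᵐ x, E • f x = diracExpr κ f g x := by
  have h : f ∈ eigenspace (dirac κ) E ↔ (f, E • f) ∈ diracGraph κ := by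
    rw [← dirac_graph]
    rfl
  rw [h]
  refine exists_congr fun g => and_congr_right fun _ => ?_
  constructor
  · intro h1
    filter_upwards [h1, Lp.coeFn_smul E f] with x h1 h2
    rw [← h1, h2, Pi.smul_apply]
  · intro h1
    filter_upwards [h1, Lp.coeFn_smul E f] with x h1 h2
    rw [← h1, h2, Pi.smul_apply]

/-- `E` is an eigenvalue of `T`. -/
def IsEigenvalue (T : H →ₗ.[ℂ] H) (E : ℂ) : Prop := eigenspace T E ≠ ⊥

/-- `E` is a simple eigenvalue of `T`: its eigenspace is a line. -/
def IsSimpleEigenvalue (T : H →ₗ.[ℂ] H) (E : ℂ) : Prop := Module.finrank ℂ (eigenspace T E) = 1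

/-- `κ` is a domain wall function with asymptotic values `±κinf`, where `κinf > 0`. -/
structure IsDomainWall (κ : ℝ → ℝ) (κinf : ℝ) : Prop where
  pos : 0 < κinf
  contDiff : ContDiff ℝ 1 κ
  odd : Function.Odd κ
  eq_of_one_le : ∀ x, 1 ≤ x → κ x = κinf
  eq_of_le_neg_one : ∀ x, x ≤ -1 → κ x = -κinf

/-- The two domain wall mass function
(the two cases agree at `x = 0` because `κ` is odd in all uses). -/
def twoWall (κ : ℝ → ℝ) (δ : ℝ) (x : ℝ) : ℝ :=
  if x ≤ 0 then -κ (x + δ) else κ (x - δ)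

/-- The normalization constant `γ = 1 / (√2 ‖exp (-∫₀ˣ κ)‖_{L²})`. -/
def gammaConst (κ : ℝ → ℝ) : ℝ :=
  1 / (√2 * (eLpNorm (fun x : ℝ => Real.exp (-∫ y in (0 : ℝ)..x, κ y)) 2 volume).toReal)

/-- The zero mode `α⋆(x) = γ (1, i)ᵀ exp (-∫₀ˣ κ)` of the one domain wall operator. -/
def zeroMode (κ : ℝ → ℝ) (x : ℝ) : Spinor :=
  ((gammaConst κ * Real.exp (-∫ y in (0 : ℝ)..x, κ y) : ℝ) : ℂ) • !₂[(1 : ℂ), Complex.I]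

/-- The right shifted zero mode `α⋆ᴿ(x) = α⋆(x - δ)`. -/
def zeroModeR (κ : ℝ → ℝ) (δ : ℝ) (x : ℝ) : Spinor := zeroMode κ (x - δ)

/-- The left shifted zero mode, the componentwise complex conjugate of `α⋆(x + δ)`. -/
def zeroModeL (κ : ℝ → ℝ) (δ : ℝ) (x : ℝ) : Spinor :=
  WithLp.toLp 2 fun j => star (zeroMode κ (x + δ) j)

/-- The spectral gap assumption on the one domain wall operator: `‖D_κ f‖ ≥ κinf ‖f‖` for all `f` in
the domain `H¹(ℝ; ℂ²)` that are orthogonal to the zero mode. -/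
def SpectralGap (κ : ℝ → ℝ) (κinf : ℝ) : Prop :=
  ∀ f : (dirac κ).domain, ∫ x, inner ℂ (zeroMode κ x) ((f : H) x) = 0 →
    κinf * ‖(f : H)‖ ≤ ‖dirac κ f‖

end DomainWall

end

noncomputable section

/-! In the spinor directions (1, i) and i(1, -i) the Dirac operator is off-diagonal: it sends the
pair of components (a, b) to (-(b' - m b), a' + m a). The two wall mass m is even, so the reflection
x ↦ -x reduces it further. On pairs with b(x) = s a(-x), s = ±1, the equation with eigenvalue E
becomes T a = sE a, where T f = (f' + m f)(-·) is a real symmetric scalar operator. Each eigenvalue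
E₀ of T thus yields the two eigenvalues ±E₀ of the Dirac operator, and it remains to show that T has
exactly one simple eigenvalue in [-K, K].

T is used only through its inverse B = `green m`, an integral operator with the symmetric kernel
exp(-(P(x) + P(y))) on x + y > 0, where P is the primitive of m. As P is odd, P(x) + P(y) is the
integral of m over [-y, x], which grows linearly in x + y; so a Schur test bounds B on L², and no
domain of T has to be handled.

Near the right wall T has an almost null vector, the shifted zero mode; near the left wall f' + m f
has the opposite sign of κ and no almost null vector at all. A sine/cosine partition of unity with
derivative O(1/δ) and the one wall gap therefore give ‖T f‖ ≥ L‖f‖ for f orthogonal to the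
quasimode, for any L < κinf and δ large (`SpectralGap.localization`,
`SpectralGap.exists_green_gap`).

The quasimode q is the right zero mode cut off near the left wall. With source s = T q one has ‖q -
p‖ and ‖s‖ of size exp(-2κinf δ), p being the unit shifted profile, and ⟨q, s⟩ is exactly the
leading term 2γ² exp(-2∫κ). An abstract fixed point argument (`exists_eigenvector_near`) then gives
an eigenvector at distance O(‖s‖), with eigenvalue ⟨q, s⟩ up to a quadratic error, which is the rate
exp(-4κinf δ). Uniqueness and simplicity follow from the gap (`eigenvector_unique`). Finally
`assemble` carries the scalar eigenvector isometrically to the two spinors, and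
`eigenspace_dirac_classification` shows that there are no others. -/

namespace DomainWall

/-! ### Eigenvector near a quasimode, in terms of the inverse operator -/

section Abstract

variable {X : Type*} [NormedAddCommGroup X] [InnerProductSpace ℝ X]

/-- A symmetric operator with bounded below inverse on the complement of a quasimode `φ = B ψ`:
solvability of the projected equation. -/
lemma exists_reduced_solution {B : X →ₗ[ℝ] X} (hB : ∀ x y, inner ℝ (B x) y = inner ℝ x (B y))
    {φ ψ : X} (hφ : ‖φ‖ = 1) (hψ : B ψ = φ) {ε L : ℝ} (hε : ‖ψ‖ ≤ ε)
    (hεL : ε ≤ L / 8) (hgap : ∀ h, inner ℝ φ (B h) = 0 → L * ‖B h‖ ≤ ‖h‖) :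
    ∃ S : X →ₗ[ℝ] X, ∀ h, inner ℝ φ h = 0 → inner ℝ φ (S h) = 0 ∧
      (L - ε) * ‖S h‖ ≤ ‖h‖ ∧ S h = B (h + inner ℝ ψ (S h) • φ) := by
  have hφφ : inner ℝ φ φ = 1 := by rw [real_inner_self_eq_norm_sq, hφ]; norm_num
  -- If this vanished, the gap would give L‖Bφ‖ ≤ 1, while ⟨ψ, Bφ⟩ = ⟨φ, φ⟩ = 1 forces ε‖Bφ‖ ≥ 1;
  -- this contradicts ε ≤ L/8.
  have hb : inner ℝ φ (B φ) ≠ 0 := by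
    intro h0
    have h1 := hgap φ h0
    have h2 : inner ℝ ψ (B φ) = 1 := by rw [← hB, hψ, hφφ]
    have h3 := real_inner_le_norm ψ (B φ)
    rw [h2] at h3
    rw [hφ] at h1
    nlinarith [norm_nonneg (B φ), norm_nonneg ψ]
  set b := inner ℝ φ (B φ) with hbdef
  -- The multiple of φ is the Lagrange multiplier that makes the image under B orthogonal to φ, so S
  -- inverts the compression of B⁻¹ to the complement of φ.
  let S : X →ₗ[ℝ] X :=
    B.comp (LinearMap.id - (b⁻¹ • (innerₛₗ ℝ φ).comp B).smulRight φ)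
  have hS : ∀ h, S h = B (h - (b⁻¹ * inner ℝ φ (B h)) • φ) := fun h => rfl
  refine ⟨S, fun h hh => ?_⟩
  have horth : inner ℝ φ (S h) = 0 := by
    rw [hS, map_sub, map_smul, inner_sub_right, inner_smul_right, ← hbdef]
    field_simp
    ring
  have hc : inner ℝ ψ (S h) = -(b⁻¹ * inner ℝ φ (B h)) := by
    rw [hS, ← hB, hψ, inner_sub_right, inner_smul_right, hφφ, hh]
    ring
  have hrep : S h = B (h + inner ℝ ψ (S h) • φ) := by
    conv_lhs => rw [hS]
    rw [hc, neg_smul, sub_eq_add_neg]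
  refine ⟨horth, ?_, hrep⟩
  have h1 : L * ‖S h‖ ≤ ‖h + inner ℝ ψ (S h) • φ‖ := by
    have := hgap (h + inner ℝ ψ (S h) • φ) (by rw [← hrep]; exact horth)
    rwa [← hrep] at this
  have h2 : ‖h + inner ℝ ψ (S h) • φ‖ ≤ ‖h‖ + ε * ‖S h‖ := by
    refine (norm_add_le _ _).trans ?_
    rw [norm_smul, hφ, mul_one]
    have := abs_real_inner_le_norm ψ (S h)
    rw [Real.norm_eq_abs]
    nlinarith [norm_nonneg (S h)]
  nlinarith

/-- Formally write T = B⁻¹, so T φ = ψ, and look for f = φ + g with g ⟂ φ. The φ component of T f =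
E f gives E = a + ⟨ψ, g⟩ with a = ⟨φ, ψ⟩; the orthogonal component is a quadratic equation for g,
solved by contraction. Since ‖g‖ = O(ε), the correction ⟨ψ, g⟩ is O(ε²). -/
lemma exists_eigenvector_near [CompleteSpace X] {B : X →ₗ[ℝ] X}
    (hB : ∀ x y, inner ℝ (B x) y = inner ℝ x (B y))
    {φ ψ : X} (hφ : ‖φ‖ = 1) (hψ : B ψ = φ) {ε L : ℝ} (hL : 0 < L) (hε : ‖ψ‖ ≤ ε)
    (hεL : ε ≤ L / 8) (hgap : ∀ h, inner ℝ φ (B h) = 0 → L * ‖B h‖ ≤ ‖h‖) :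
    ∃ (E : ℝ) (f : X), f = E • B f ∧ inner ℝ φ f = 1 ∧ ‖f - φ‖ ≤ 4 * ε / L ∧
      |E - inner ℝ φ ψ| ≤ 4 * ε ^ 2 / L := by
  obtain ⟨S, hS⟩ := exists_reduced_solution hB hφ hψ hε hεL hgap
  have hφφ : inner ℝ φ φ = 1 := by rw [real_inner_self_eq_norm_sq, hφ]; norm_num
  have hε0 : 0 ≤ ε := (norm_nonneg _).trans hε
  set a := inner ℝ φ ψ with ha
  have haε : |a| ≤ ε := by
    have := abs_real_inner_le_norm φ ψ
    rw [hφ, one_mul] at this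
    exact this.trans hε
  set q := ψ - a • φ with hq
  have hqφ : inner ℝ φ q = 0 := by
    rw [hq, inner_sub_right, inner_smul_right, hφφ, ← ha]; ring
  have hqn : ‖q‖ ≤ ε := by
    have h1 : ‖q‖ ^ 2 + a ^ 2 = ‖ψ‖ ^ 2 := by
      have e : ψ = q + a • φ := by rw [hq]; abel
      conv_rhs => rw [e, norm_add_sq_real, inner_smul_right, real_inner_comm, hqφ, norm_smul, hφ,
        Real.norm_eq_abs]
      rw [mul_one, sq_abs]; ring
    have : ‖q‖ ^ 2 ≤ ε ^ 2 := by nlinarith [norm_nonneg ψ, sq_nonneg a]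
    exact le_of_sq_le_sq this hε0
  -- The first approximation to g is -S q, of norm at most ε/(L - ε); this radius leaves room for
  -- the quadratic term, and ε ≤ L/8 makes it at most 1/2.
  set r := 4 * ε / L with hr
  have hr0 : 0 ≤ r := by positivity
  have hrL : r * L = 4 * ε := by rw [hr]; field_simp
  have hr2 : r ≤ 1 / 2 := by rw [hr, div_le_iff₀ hL]; linarith
  let G : X → X := fun g => S ((a + inner ℝ ψ g) • g - q)
  let s : Set X := {g | inner ℝ φ g = 0 ∧ ‖g‖ ≤ r}
  have hsc : IsComplete s := by
    refine IsClosed.isComplete ?_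
    exact (isClosed_eq (by fun_prop) continuous_const).inter
      (isClosed_le continuous_norm continuous_const)
  have harg : ∀ g ∈ s, inner ℝ φ ((a + inner ℝ ψ g) • g - q) = 0 := by
    intro g hg
    rw [inner_sub_right, inner_smul_right, hg.1, hqφ]; ring
  have hin : ∀ g : X, |inner ℝ ψ g| ≤ ε * ‖g‖ := fun g =>
    (abs_real_inner_le_norm ψ g).trans (mul_le_mul_of_nonneg_right hε (norm_nonneg _))
  have hmaps : Set.MapsTo G s s := by
    intro g hg
    obtain ⟨h1, h2, -⟩ := hS _ (harg g hg)
    refine ⟨h1, ?_⟩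
    have h3 : ‖(a + inner ℝ ψ g) • g - q‖ ≤ (ε + ε * r) * r + ε := by
      refine (norm_sub_le _ _).trans (add_le_add ?_ hqn)
      rw [norm_smul, Real.norm_eq_abs]
      refine mul_le_mul ?_ hg.2 (norm_nonneg _) (by positivity)
      refine (abs_add_le _ _).trans (add_le_add haε ((hin g).trans ?_))
      exact mul_le_mul_of_nonneg_left hg.2 hε0
    have h4 : (L - ε) * ‖G g‖ ≤ (L - ε) * r := by
      refine (h2.trans h3).trans ?_
      nlinarith [mul_nonneg hε0 hr0, mul_nonneg (mul_nonneg hε0 hr0) hr0]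
    exact le_of_mul_le_mul_left h4 (by linarith)
  have hcontr : ContractingWith (1 / 2) (hmaps.restrict G s s) := by
    refine ⟨by norm_num, LipschitzWith.of_dist_le_mul ?_⟩
    rintro ⟨g, hg⟩ ⟨g', hg'⟩
    have hd : G g - G g' = S ((a + inner ℝ ψ g) • (g - g') + inner ℝ ψ (g - g') • g') := by
      change S _ - S _ = _
      rw [← map_sub]
      congr 1
      rw [inner_sub_right]
      module
    have ho : inner ℝ φ ((a + inner ℝ ψ g) • (g - g') + inner ℝ ψ (g - g') • g') = 0 := by
      rw [inner_add_right, inner_smul_right, inner_smul_right, inner_sub_right, hg.1, hg'.1]; ring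
    have h2 := (hS _ ho).2.1
    rw [← hd] at h2
    have h3 : ‖(a + inner ℝ ψ g) • (g - g') + inner ℝ ψ (g - g') • g'‖
        ≤ (ε + ε * r) * ‖g - g'‖ + (ε * ‖g - g'‖) * r := by
      refine (norm_add_le _ _).trans (add_le_add ?_ ?_)
      · rw [norm_smul, Real.norm_eq_abs]
        refine mul_le_mul_of_nonneg_right ?_ (norm_nonneg _)
        refine (abs_add_le _ _).trans (add_le_add haε ((hin g).trans ?_))
        exact mul_le_mul_of_nonneg_left hg.2 hε0
      · rw [norm_smul, Real.norm_eq_abs]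
        exact mul_le_mul (hin _) hg'.2 (norm_nonneg _) (by positivity)
    change dist (G g) (G g') ≤ ((1 / 2 : NNReal) : ℝ) * dist g g'
    rw [dist_eq_norm, dist_eq_norm]
    have h4 : (L - ε) * ‖G g - G g'‖ ≤ (L - ε) * (1 / 2 * ‖g - g'‖) := by
      refine (h2.trans h3).trans ?_
      have := norm_nonneg (g - g')
      have h5 : ε + ε * r + ε * r ≤ (L - ε) * (1 / 2) := by nlinarith
      nlinarith
    simpa using le_of_mul_le_mul_left h4 (by linarith)
  have h0s : (0 : X) ∈ s := ⟨by simp, by simpa using hr0⟩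
  obtain ⟨g, hg, hfix, -⟩ := ContractingWith.exists_fixedPoint' hsc hmaps hcontr h0s
    (edist_ne_top _ _)
  have hfix' : S ((a + inner ℝ ψ g) • g - q) = g := hfix
  have hrep := (hS _ (harg g hg)).2.2
  rw [hfix'] at hrep
  refine ⟨a + inner ℝ ψ g, φ + g, ?_, ?_, ?_, ?_⟩
  · have e : (a + inner ℝ ψ g) • g - q + inner ℝ ψ g • φ
        = (a + inner ℝ ψ g) • (φ + g) - ψ := by
      rw [hq]; module
    rw [e, map_sub, map_smul, hψ] at hrep
    conv_lhs => rw [hrep]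
    abel
  · rw [inner_add_right, hφφ, hg.1, add_zero]
  · rw [add_sub_cancel_left]; exact hg.2
  · rw [add_sub_cancel_left]
    refine (hin g).trans ?_
    calc ε * ‖g‖ ≤ ε * r := mul_le_mul_of_nonneg_left hg.2 hε0
      _ = 4 * ε ^ 2 / L := by rw [hr]; ring

/-- The combination g - c f is orthogonal to φ, so the gap applies to it. For E' = E it is an
eigenvector below the gap, hence zero. For E' ≠ E symmetry gives g ⟂ f, and Pythagoras on both sides
of the gap inequality leaves no room for g ≠ 0. -/
lemma eigenvector_unique {B : X →ₗ[ℝ] X} (hB : ∀ x y, inner ℝ (B x) y = inner ℝ x (B y))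
    {φ f g : X} {L E E' : ℝ} (hgap : ∀ h, inner ℝ φ (B h) = 0 → L * ‖B h‖ ≤ ‖h‖)
    (hf : f = E • B f) (hφf : inner ℝ φ f = 1) (hE : |E| < L) (hg : g = E' • B g)
    (hE' : |E'| < L) : g = inner ℝ φ g • f ∧ (g ≠ 0 → E' = E) := by
  set c := inner ℝ φ g with hc
  have hf0 : f ≠ 0 := by rintro rfl; simp at hφf
  have hx : g - c • f = B (E' • g - (c * E) • f) := by
    rw [map_sub, map_smul, map_smul, ← hg, mul_smul, ← hf]
  have ho : inner ℝ φ (g - c • f) = 0 := by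
    rw [inner_sub_right, inner_smul_right, hφf, ← hc]; ring
  have hb := hgap _ (by rw [← hx]; exact ho)
  rw [← hx] at hb
  by_cases hEE : E' = E
  · refine ⟨?_, fun _ => hEE⟩
    have e : E' • g - (c * E) • f = E • (g - c • f) := by rw [hEE]; module
    rw [e, norm_smul, Real.norm_eq_abs] at hb
    have : ‖g - c • f‖ ≤ 0 := by
      by_contra h
      push Not at h
      nlinarith
    exact sub_eq_zero.1 (norm_le_zero_iff.1 this)
  · have horth : inner ℝ g f = 0 := by
      have h1 : inner ℝ g f = E' * inner ℝ (B g) f := by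
        conv_lhs => rw [hg, inner_smul_left]
        simp
      have h2 : inner ℝ g f = E * inner ℝ (B g) f := by
        conv_lhs => rw [hf, inner_smul_right, ← hB]
      have h3 : (E' - E) * inner ℝ (B g) f = 0 := by linarith
      rcases mul_eq_zero.1 h3 with h | h
      · exact absurd (sub_eq_zero.1 h) hEE
      · rw [h1, h, mul_zero]
    have hn1 : ‖g - c • f‖ ^ 2 = ‖g‖ ^ 2 + c ^ 2 * ‖f‖ ^ 2 := by
      rw [norm_sub_sq_real, inner_smul_right, horth, norm_smul, mul_pow, Real.norm_eq_abs, sq_abs]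
      ring
    have hn2 : ‖E' • g - (c * E) • f‖ ^ 2 = E' ^ 2 * ‖g‖ ^ 2 + c ^ 2 * E ^ 2 * ‖f‖ ^ 2 := by
      rw [norm_sub_sq_real, inner_smul_right, inner_smul_left, horth, norm_smul, norm_smul,
        mul_pow, mul_pow, Real.norm_eq_abs, Real.norm_eq_abs, sq_abs, sq_abs]
      ring
    have hL : 0 < L := (abs_nonneg _).trans_lt hE
    have hsq : L ^ 2 * ‖g - c • f‖ ^ 2 ≤ ‖E' • g - (c * E) • f‖ ^ 2 := by
      rw [← mul_pow]
      exact pow_le_pow_left₀ (by positivity) hb 2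
    rw [hn1, hn2] at hsq
    have hE2 : E ^ 2 < L ^ 2 := by rw [← sq_abs]; exact pow_lt_pow_left₀ hE (abs_nonneg _) two_ne_zero
    have hE2' : E' ^ 2 < L ^ 2 := by
      rw [← sq_abs]; exact pow_lt_pow_left₀ hE' (abs_nonneg _) two_ne_zero
    have hg0 : g = 0 := by
      by_contra h
      have : 0 < ‖g‖ ^ 2 := by positivity
      nlinarith [mul_nonneg (sq_nonneg c) (sq_nonneg ‖f‖)]
    refine ⟨?_, fun h => absurd hg0 h⟩
    rw [hc, hg0]; simp

end Abstract

/-! ### Schur test for kernels dominated by a function of x + y -/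

section Schur

variable {k : ℝ → ℝ → ℝ} {G h g : ℝ → ℝ}

lemma integrable_add_mul_left (hG : Integrable G) (hh : Integrable h) :
    Integrable (fun p : ℝ × ℝ => G (p.1 + p.2) * h p.1) (volume.prod volume) := by
  have h1 := (measurePreserving_prod_add (volume : Measure ℝ) (volume : Measure ℝ))
    |>.integrable_comp_of_integrable (hh.mul_prod hG)
  exact h1.congr (Filter.Eventually.of_forall fun p => by simp [mul_comm])

lemma integrable_add_mul_right (hG : Integrable G) (hh : Integrable h) :
    Integrable (fun p : ℝ × ℝ => G (p.1 + p.2) * h p.2) (volume.prod volume) := by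
  have h1 := (integrable_add_mul_left hG hh).swap
  exact h1.congr (Filter.Eventually.of_forall fun p => by simp [add_comm])

/-- The kernel `k` is measurable and dominated by an integrable function of `x + y`. -/
structure IsDominatedKernel (k : ℝ → ℝ → ℝ) (G : ℝ → ℝ) : Prop where
  measurable : Measurable (Function.uncurry k)
  le : ∀ x y, |k x y| ≤ G (x + y)
  integrable : Integrable G
  memLp_majorant : MemLp G 2 volume

namespace IsDominatedKernel

lemma nonneg (hk : IsDominatedKernel k G) (s : ℝ) : 0 ≤ G s := by
  have := hk.le s 0
  rw [add_zero] at this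
  exact (abs_nonneg _).trans this

lemma integrable_majorant (hk : IsDominatedKernel k G) (hh : MemLp h 2 volume) (x : ℝ) :
    Integrable fun y => G (x + y) * |h y| :=
  (hk.memLp_majorant.comp_measurePreserving (measurePreserving_add_left volume x)).integrable_mul hh.abs

lemma integrable_mul (hk : IsDominatedKernel k G) (hh : MemLp h 2 volume) (x : ℝ) :
    Integrable fun y => k x y * h y := by
  refine (hk.integrable_majorant hh x).mono' ?_ ?_
  · exact (hk.measurable.of_uncurry_left.aestronglyMeasurable).mul hh.1
  · filter_upwards with y
    rw [norm_mul, Real.norm_eq_abs, Real.norm_eq_abs]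
    exact mul_le_mul_of_nonneg_right (hk.le x y) (abs_nonneg _)

/-- Cauchy–Schwarz for the weight G(x + y), read off from the discriminant of the nonnegative
quadratic t ↦ ∫ G(x + y)(|h y| - t)² dy. -/
lemma sq_integral_le (hk : IsDominatedKernel k G) (hh : MemLp h 2 volume) (x : ℝ)
    (hx : Integrable fun y => G (x + y) * h y ^ 2) :
    (∫ y, k x y * h y) ^ 2 ≤ (∫ s, G s) * ∫ y, G (x + y) * h y ^ 2 := by
  set p := ∫ y, G (x + y) * |h y| with hp
  have hG' : Integrable fun y => G (x + y) := hk.integrable.comp_add_left x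
  have ha : ∫ y, G (x + y) = ∫ s, G s := integral_add_left_eq_self G x
  have h1 : |∫ y, k x y * h y| ≤ p := by
    rw [← Real.norm_eq_abs]
    refine norm_integral_le_of_norm_le (hk.integrable_majorant hh x) ?_
    filter_upwards with y
    rw [norm_mul, Real.norm_eq_abs, Real.norm_eq_abs]
    exact mul_le_mul_of_nonneg_right (hk.le x y) (abs_nonneg _)
  have h2 : ∀ t : ℝ, 0 ≤ (∫ s, G s) * (t * t) + (-2 * p) * t + ∫ y, G (x + y) * h y ^ 2 := by
    intro t
    have e : ∫ y, G (x + y) * (|h y| - t) ^ 2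
        = (∫ s, G s) * (t * t) + (-2 * p) * t + ∫ y, G (x + y) * h y ^ 2 := by
      have e1 : (fun y => G (x + y) * (|h y| - t) ^ 2) = fun y => (t * t) * G (x + y)
          + (-2 * t) * (G (x + y) * |h y|) + G (x + y) * h y ^ 2 := by
        funext y
        rw [← sq_abs (h y)]; ring
      have i1 : Integrable fun y => (t * t) * G (x + y) + (-2 * t) * (G (x + y) * |h y|) :=
        (hG'.const_mul _).add ((hk.integrable_majorant hh x).const_mul _)
      rw [e1, integral_add i1 hx,
        integral_add (hG'.const_mul _) ((hk.integrable_majorant hh x).const_mul _),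
        integral_const_mul, integral_const_mul, ha, ← hp]
      ring
    rw [← e]
    exact integral_nonneg fun y => mul_nonneg (hk.nonneg _) (sq_nonneg _)
  have h3 := discrim_le_zero h2
  rw [discrim] at h3
  have h4 : (∫ y, k x y * h y) ^ 2 ≤ p ^ 2 := by
    rw [← sq_abs]
    exact pow_le_pow_left₀ (abs_nonneg _) h1 2
  nlinarith

lemma aestronglyMeasurable_integral (hk : IsDominatedKernel k G) (hh : MemLp h 2 volume) :
    AEStronglyMeasurable (fun x => ∫ y, k x y * h y) volume := by
  have : AEStronglyMeasurable (fun p : ℝ × ℝ => k p.1 p.2 * h p.2) (volume.prod volume) :=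
    hk.measurable.aestronglyMeasurable.mul hh.1.comp_snd
  exact this.integral_prod_right'

lemma memLp (hk : IsDominatedKernel k G) (hh : MemLp h 2 volume) :
    MemLp (fun x => ∫ y, k x y * h y) 2 volume := by
  have hm := hk.aestronglyMeasurable_integral hh
  rw [memLp_two_iff_integrable_sq hm]
  have hint := integrable_add_mul_right hk.integrable hh.integrable_sq
  refine (hint.integral_prod_left.const_mul (∫ s, G s)).mono' (hm.pow 2) ?_
  filter_upwards [hint.prod_right_ae] with x hx
  rw [Real.norm_eq_abs, abs_of_nonneg (sq_nonneg _)]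
  exact hk.sq_integral_le hh x hx

lemma integrable_prod (hk : IsDominatedKernel k G) (hh : MemLp h 2 volume)
    (hg : MemLp g 2 volume) :
    Integrable (fun p : ℝ × ℝ => k p.1 p.2 * h p.2 * g p.1) (volume.prod volume) := by
  have h1 := integrable_add_mul_right hk.integrable hh.integrable_sq
  have h2 := integrable_add_mul_left hk.integrable hg.integrable_sq
  refine (h1.add h2).mono' ?_ ?_
  · exact (hk.measurable.aestronglyMeasurable.mul hh.1.comp_snd).mul hg.1.comp_fst
  · filter_upwards with p
    rw [norm_mul, norm_mul, Real.norm_eq_abs, Real.norm_eq_abs, Real.norm_eq_abs, mul_assoc,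
      Pi.add_apply]
    refine (mul_le_mul_of_nonneg_right (hk.le p.1 p.2) (by positivity)).trans ?_
    rw [← mul_add]
    refine mul_le_mul_of_nonneg_left ?_ (hk.nonneg _)
    rw [← sq_abs (h p.2), ← sq_abs (g p.1)]
    nlinarith [sq_nonneg (|h p.2| - |g p.1|), sq_nonneg (|h p.2| + |g p.1|)]

lemma integral_symm (hk : IsDominatedKernel k G) (hs : ∀ x y, k x y = k y x)
    (hh : MemLp h 2 volume) (hg : MemLp g 2 volume) :
    ∫ x, (∫ y, k x y * h y) * g x = ∫ x, h x * ∫ y, k x y * g y := by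
  simp_rw [← integral_mul_const, ← integral_const_mul]
  rw [integral_integral_swap (hk.integrable_prod hh hg)]
  refine integral_congr_ae (Filter.Eventually.of_forall fun y => ?_)
  refine integral_congr_ae (Filter.Eventually.of_forall fun x => ?_)
  simp only [hs x y]
  ring

end IsDominatedKernel

end Schur

/-! ### Weak derivatives of scalar functions -/

/-- `g` is the weak derivative of the real function `f`. -/
def IsWeakDeriv (f g : ℝ → ℝ) : Prop :=
  ∀ φ : ℝ → ℝ, ContDiff ℝ ∞ φ → HasCompactSupport φ → ∫ x, deriv φ x * f x = -∫ x, φ x * g x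

lemma integrable_continuous_mul {φ f : ℝ → ℝ} (hφ : Continuous φ) (hc : HasCompactSupport φ)
    (hf : MemLp f 2 volume) : Integrable fun x => φ x * f x :=
  (hf.locallyIntegrable (by norm_num)).integrable_smul_left_of_hasCompactSupport hφ hc

namespace IsWeakDeriv

variable {f f' g g' : ℝ → ℝ}

lemma congr_ae (h : IsWeakDeriv f f') (hf : f =ᵐ[volume] g) (hf' : f' =ᵐ[volume] g') :
    IsWeakDeriv g g' := by
  intro φ h1 h2
  have e := h φ h1 h2
  have e1 : ∫ x, deriv φ x * f x = ∫ x, deriv φ x * g x :=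
    integral_congr_ae (by filter_upwards [hf] with x hx; rw [hx])
  have e2 : ∫ x, φ x * f' x = ∫ x, φ x * g' x :=
    integral_congr_ae (by filter_upwards [hf'] with x hx; rw [hx])
  rw [← e1, ← e2, e]

lemma add (h : IsWeakDeriv f f') (hg : IsWeakDeriv g g') (mf : MemLp f 2 volume)
    (mf' : MemLp f' 2 volume) (mg : MemLp g 2 volume) (mg' : MemLp g' 2 volume) :
    IsWeakDeriv (fun x => f x + g x) (fun x => f' x + g' x) := by
  intro φ h1 h2
  have hd : Continuous (deriv φ) := h1.continuous_deriv (by simp)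
  simp_rw [mul_add]
  rw [integral_add (integrable_continuous_mul hd h2.deriv mf)
      (integrable_continuous_mul hd h2.deriv mg),
    integral_add (integrable_continuous_mul h1.continuous h2 mf')
      (integrable_continuous_mul h1.continuous h2 mg'), h φ h1 h2, hg φ h1 h2]
  ring

lemma const_mul (h : IsWeakDeriv f f') (c : ℝ) :
    IsWeakDeriv (fun x => c * f x) (fun x => c * f' x) := by
  intro φ h1 h2
  simp_rw [mul_left_comm _ c]
  rw [integral_const_mul, integral_const_mul, h φ h1 h2]
  ring

lemma sub (h : IsWeakDeriv f f') (hg : IsWeakDeriv g g') (mf : MemLp f 2 volume)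
    (mf' : MemLp f' 2 volume) (mg : MemLp g 2 volume) (mg' : MemLp g' 2 volume) :
    IsWeakDeriv (fun x => f x - g x) (fun x => f' x - g' x) := by
  have := h.add (hg.const_mul (-1)) mf mf' (mg.const_mul (-1)) (mg'.const_mul (-1))
  simpa only [neg_one_mul, ← sub_eq_add_neg] using this

lemma comp_add (h : IsWeakDeriv f f') (a : ℝ) :
    IsWeakDeriv (fun x => f (x + a)) (fun x => f' (x + a)) := by
  intro φ h1 h2
  have hc : HasCompactSupport fun x => φ (x - a) :=
    h2.comp_homeomorph (Homeomorph.subRight a)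
  have e := h (fun x => φ (x - a)) (h1.comp (contDiff_id.sub contDiff_const)) hc
  rw [← integral_add_right_eq_self _ a, ← integral_add_right_eq_self (fun x => _ * f' x) a] at e
  simpa only [deriv_comp_sub_const, add_sub_cancel_right] using e

lemma comp_neg (h : IsWeakDeriv f f') :
    IsWeakDeriv (fun x => f (-x)) (fun x => -f' (-x)) := by
  intro φ h1 h2
  have hc : HasCompactSupport fun x => φ (-x) := h2.comp_homeomorph (Homeomorph.neg ℝ)
  have e := h (fun x => φ (-x)) (h1.comp contDiff_neg) hc
  rw [← integral_neg_eq_self, ← integral_neg_eq_self (fun x => _ * f' x)] at e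
  simp only [deriv_comp_neg, neg_neg, neg_mul, integral_neg] at e
  simp only [mul_neg, integral_neg, neg_neg]
  linarith

/-- The Leibniz rule with a smooth factor. -/
lemma smooth_mul {J : ℝ → ℝ} (hJ : ContDiff ℝ ∞ J) (h : IsWeakDeriv f f')
    (mf : MemLp f 2 volume) (mf' : MemLp f' 2 volume) :
    IsWeakDeriv (fun x => J x * f x) (fun x => deriv J x * f x + J x * f' x) := by
  intro φ h1 h2
  have e := h (fun x => φ x * J x) (h1.mul hJ) h2.mul_right
  have hd : ∀ x, deriv (fun x => φ x * J x) x = deriv φ x * J x + φ x * deriv J x := fun x =>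
    deriv_fun_mul (h1.differentiable (by simp) x) (hJ.differentiable (by simp) x)
  have cd : Continuous (deriv φ) := h1.continuous_deriv (by simp)
  have cJ : Continuous (deriv J) := hJ.continuous_deriv (by simp)
  simp_rw [hd] at e
  have i1 := integrable_continuous_mul (cd.mul hJ.continuous) h2.deriv.mul_right mf
  have i2 := integrable_continuous_mul (h1.continuous.mul cJ) h2.mul_right mf
  have i3 := integrable_continuous_mul (h1.continuous.mul hJ.continuous) h2.mul_right mf'
  simp only [Pi.mul_apply] at i1 i2 i3
  have e1 : ∫ x, (deriv φ x * J x + φ x * deriv J x) * f x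
      = (∫ x, deriv φ x * J x * f x) + ∫ x, φ x * deriv J x * f x := by
    rw [← integral_add i1 i2]
    simp only [add_mul]
  have e2 : ∫ x, φ x * (deriv J x * f x + J x * f' x)
      = (∫ x, φ x * deriv J x * f x) + ∫ x, φ x * J x * f' x := by
    rw [← integral_add i2 i3]
    simp only [mul_add, mul_assoc]
  rw [e2]
  simp only [← mul_assoc] at e1 e ⊢
  linarith

/-- Weak derivatives may be tested with compactly supported `C¹` functions. -/
lemma integral_deriv_mul (h : IsWeakDeriv f f') (mf : MemLp f 2 volume) (mf' : MemLp f' 2 volume)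
    {η : ℝ → ℝ} (h1 : ContDiff ℝ 1 η) (h2 : HasCompactSupport η) :
    ∫ x, deriv η x * f x = -∫ x, η x * f' x := by
  have cd : Continuous (deriv η) := h1.continuous_deriv le_rfl
  -- Mollifiers with outer radius 1/(n + 1) ≤ 1: all mollified test functions vanish outside |x| ≤ R
  -- + 1, which supplies a common dominating function.
  let ρ : ℕ → ContDiffBump (0 : ℝ) := fun n =>
    ⟨1 / (n + 2), 1 / (n + 1), by positivity, by
      apply one_div_lt_one_div_of_lt <;> first | positivity | linarith⟩
  let w : ℕ → ℝ → ℝ := fun n =>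
    MeasureTheory.convolution ((ρ n).normed volume) η (ContinuousLinearMap.lsmul ℝ ℝ) volume
  have hρ : Filter.Tendsto (fun n => (ρ n).rOut) Filter.atTop (nhds 0) :=
    tendsto_one_div_add_atTop_nhds_zero_nat
  have hw : ∀ n, ContDiff ℝ ∞ (w n) := fun n =>
    HasCompactSupport.contDiff_convolution_left _ (ρ n).hasCompactSupport_normed
      (ρ n).contDiff_normed h1.continuous.locallyIntegrable
  have hwc : ∀ n, HasCompactSupport (w n) := fun n =>
    HasCompactSupport.convolution _ (ρ n).hasCompactSupport_normed h2
  have hdw : ∀ n, deriv (w n) = MeasureTheory.convolution ((ρ n).normed volume) (deriv η)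
      (ContinuousLinearMap.lsmul ℝ ℝ) volume := fun n => by
    funext x
    exact (HasCompactSupport.hasDerivAt_convolution_right _
      ((ρ n).continuous_normed.locallyIntegrable) h2 h1 x).deriv
  obtain ⟨R, hR⟩ : ∃ R, ∀ x, R < |x| → η x = 0 := by
    obtain ⟨R, hR⟩ := h2.isCompact.isBounded.subset_closedBall 0
    refine ⟨R, fun x hx => ?_⟩
    by_contra hne
    have := hR (subset_tsupport _ hne)
    rw [Metric.mem_closedBall, Real.dist_eq, sub_zero] at this
    linarith
  have hRd : ∀ x, R < |x| → deriv η x = 0 := by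
    intro x hx
    have : η =ᶠ[nhds x] fun _ => 0 := by
      filter_upwards [(isOpen_lt continuous_const continuous_abs).mem_nhds hx] with y hy
      exact hR y hy
    rw [this.deriv_eq, deriv_const]
  have key : ∀ (θ : ℝ → ℝ), Continuous θ → HasCompactSupport θ → (∀ x, R < |x| → θ x = 0) →
      ∀ u : ℝ → ℝ, MemLp u 2 volume → Filter.Tendsto (fun n => ∫ x,
        (MeasureTheory.convolution ((ρ n).normed volume) θ
          (ContinuousLinearMap.lsmul ℝ ℝ) volume) x * u x) Filter.atTop
        (nhds (∫ x, θ x * u x)) := by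
    intro θ cθ hθ hθR u hu
    obtain ⟨M, hM⟩ := hθ.exists_bound_of_continuous cθ
    have hM0 : 0 ≤ M := (norm_nonneg _).trans (hM 0)
    have cv : ∀ n, Continuous (MeasureTheory.convolution ((ρ n).normed volume) θ
        (ContinuousLinearMap.lsmul ℝ ℝ) volume) := fun n =>
      hθ.continuous_convolution_right _ ((ρ n).continuous_normed.locallyIntegrable) cθ
    have hdist : ∀ n x, |(MeasureTheory.convolution ((ρ n).normed volume) θ
        (ContinuousLinearMap.lsmul ℝ ℝ) volume) x - θ x| ≤ 2 * M := by
      intro n x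
      rw [← Real.dist_eq]
      refine ContDiffBump.dist_normed_convolution_le cθ.aestronglyMeasurable fun y _ => ?_
      rw [dist_eq_norm]
      refine (norm_sub_le _ _).trans ?_
      linarith [hM x, hM y]
    have hzero : ∀ n x, R + 1 < |x| → (MeasureTheory.convolution ((ρ n).normed volume) θ
        (ContinuousLinearMap.lsmul ℝ ℝ) volume) x = 0 := by
      intro n x hx
      have hx0 : θ x = 0 := hθR x (by linarith)
      have hle : (ρ n).rOut ≤ 1 := by
        change (1 : ℝ) / (n + 1) ≤ 1
        rw [div_le_one (by positivity)]
        linarith [(Nat.cast_nonneg n : (0 : ℝ) ≤ n)]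
      have : dist ((MeasureTheory.convolution ((ρ n).normed volume) θ
        (ContinuousLinearMap.lsmul ℝ ℝ) volume) x) (θ x) ≤ 0 := by
        refine ContDiffBump.dist_normed_convolution_le cθ.aestronglyMeasurable fun y hy => ?_
        rw [Metric.mem_ball, Real.dist_eq] at hy
        have h3 : |x| ≤ |y| + |y - x| := by
          have := abs_sub_abs_le_abs_sub x y
          rw [abs_sub_comm x y] at this
          linarith
        rw [hx0, hθR y (by linarith), dist_self]
      rw [dist_le_zero.1 this, hx0]
    -- The factor 3M is 2M for the distance of the mollified function to θ plus M for θ itself.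
    have hb : Integrable fun x => (Set.Icc (-(R + 1)) (R + 1)).indicator (fun x => 3 * M * |u x|) x := by
      rw [integrable_indicator_iff measurableSet_Icc]
      exact (((hu.locallyIntegrable (by norm_num)).integrableOn_isCompact isCompact_Icc).abs).const_mul _
    refine tendsto_integral_of_dominated_convergence _
      (fun n => (cv n).aestronglyMeasurable.mul hu.1) hb (fun n => ?_) ?_
    · filter_upwards with x
      by_cases hx : x ∈ Set.Icc (-(R + 1)) (R + 1)
      · rw [Set.indicator_of_mem hx, norm_mul, Real.norm_eq_abs, Real.norm_eq_abs]
        refine mul_le_mul_of_nonneg_right ?_ (abs_nonneg _)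
        have h4 := hdist n x
        have h5 := hM x
        rw [Real.norm_eq_abs] at h5
        have h6 := abs_sub_abs_le_abs_sub ((MeasureTheory.convolution ((ρ n).normed volume) θ
          (ContinuousLinearMap.lsmul ℝ ℝ) volume) x) (θ x)
        linarith
      · rw [Set.indicator_of_notMem hx, hzero n x, zero_mul, norm_zero]
        rw [Set.mem_Icc, ← abs_le] at hx
        exact not_le.1 hx
    · filter_upwards with x
      exact (ContDiffBump.convolution_tendsto_right_of_continuous hρ cθ x).mul_const _
  have k1 := key η h1.continuous h2 hR f' mf'
  have k2 := key (deriv η) cd h2.deriv hRd f mf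
  have k3 : ∀ n, ∫ x, (MeasureTheory.convolution ((ρ n).normed volume) (deriv η)
          (ContinuousLinearMap.lsmul ℝ ℝ) volume) x * f x = -∫ x, w n x * f' x := by
    intro n
    rw [← h (w n) (hw n) (hwc n), hdw]
  simp_rw [k3] at k2
  exact tendsto_nhds_unique k2 k1.neg

end IsWeakDeriv

/-! ### The Green operator of the reflected operator f ↦ (f' + m f)(-·) -/

/-- The primitive of `m` that vanishes at the origin. -/
def primitive (m : ℝ → ℝ) (x : ℝ) : ℝ := ∫ y in (0 : ℝ)..x, m y

lemma hasDerivAt_primitive {m : ℝ → ℝ} (hm : Continuous m) (x : ℝ) :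
    HasDerivAt (primitive m) (m x) x :=
  hm.integral_hasStrictDerivAt 0 x |>.hasDerivAt

lemma continuous_primitive {m : ℝ → ℝ} (hm : Continuous m) : Continuous (primitive m) :=
  continuous_iff_continuousAt.2 fun x => (hasDerivAt_primitive hm x).continuousAt

lemma contDiff_primitive {m : ℝ → ℝ} (hm : Continuous m) : ContDiff ℝ 1 (primitive m) := by
  rw [contDiff_one_iff_deriv]
  refine ⟨fun x => (hasDerivAt_primitive hm x).differentiableAt, ?_⟩
  rwa [funext fun x => (hasDerivAt_primitive hm x).deriv]

lemma primitive_sub {m : ℝ → ℝ} (hm : Continuous m) (s t : ℝ) :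
    primitive m t - primitive m s = ∫ y in s..t, m y :=
  intervalIntegral.integral_interval_sub_left (hm.intervalIntegrable _ _) (hm.intervalIntegrable _ _)

lemma primitive_neg_of_even {m : ℝ → ℝ} (he : Function.Even m) (x : ℝ) :
    primitive m (-x) = -primitive m x := by
  have h : ∫ y in (0 : ℝ)..x, m (-y) = ∫ y in (-x)..(-0), m y :=
    intervalIntegral.integral_comp_neg m
  simp only [he _, neg_zero] at h
  rw [primitive, primitive, h, intervalIntegral.integral_symm]

lemma primitive_neg_of_odd {m : ℝ → ℝ} (ho : Function.Odd m) (x : ℝ) :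
    primitive m (-x) = primitive m x := by
  have h : ∫ y in (0 : ℝ)..x, m (-y) = ∫ y in (-x)..(-0), m y :=
    intervalIntegral.integral_comp_neg m
  simp only [ho _, neg_zero, intervalIntegral.integral_neg] at h
  rw [primitive, primitive, intervalIntegral.integral_symm, ← h, neg_neg]

/-- Even continuous functions whose mean value on long intervals is positive. -/
structure IsConfining (m : ℝ → ℝ) : Prop where
  continuous : Continuous m
  even : Function.Even m
  lower : ∃ b c : ℝ, 0 < b ∧ ∀ s t, s ≤ t → b * (t - s) - c ≤ ∫ y in s..t, m y

/-- The integral kernel of the inverse of `f ↦ (f' + m f) ∘ (- ·)`. -/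
def greenKernel (m : ℝ → ℝ) (x y : ℝ) : ℝ :=
  if 0 < x + y then Real.exp (-(primitive m x + primitive m y)) else 0

lemma greenKernel_comm (m : ℝ → ℝ) (x y : ℝ) : greenKernel m x y = greenKernel m y x := by
  simp only [greenKernel, add_comm]

/-- The integral operator with kernel `greenKernel m`. -/
def green (m : ℝ → ℝ) (h : ℝ → ℝ) (x : ℝ) : ℝ := ∫ y, greenKernel m x y * h y

/-- The kernel factorizes on x + y > 0, which gives the variation of constants formula. -/
lemma green_eq (m h : ℝ → ℝ) (x : ℝ) :
    green m h x
      = Real.exp (-primitive m x) * ∫ y in Set.Ioi (-x), Real.exp (-primitive m y) * h y := by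
  rw [green, ← integral_const_mul, ← integral_indicator measurableSet_Ioi]
  refine integral_congr_ae (Filter.Eventually.of_forall fun y => ?_)
  by_cases hy : 0 < x + y
  · have : y ∈ Set.Ioi (-x) := by rw [Set.mem_Ioi]; linarith
    simp only [greenKernel, if_pos hy, Set.indicator_of_mem this, neg_add, Real.exp_add]
    ring
  · have : y ∉ Set.Ioi (-x) := by rw [Set.mem_Ioi]; intro h; linarith
    simp only [greenKernel, if_neg hy, Set.indicator_of_notMem this, zero_mul]

namespace IsConfining

variable {m h g : ℝ → ℝ}

lemma exists_isDominatedKernel (hm : IsConfining m) :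
    ∃ G, IsDominatedKernel (greenKernel m) G := by
  obtain ⟨b, c, hb, hlow⟩ := hm.lower
  refine ⟨(Set.Ioi 0).indicator fun s => Real.exp c * Real.exp (-b * s), ?_, ?_, ?_, ?_⟩
  · have hc := continuous_primitive hm.continuous
    refine Measurable.ite ?_ ?_ measurable_const
    · exact measurableSet_lt measurable_const (measurable_fst.add measurable_snd)
    · fun_prop
  · intro x y
    by_cases hxy : 0 < x + y
    · rw [greenKernel, if_pos hxy, Set.indicator_of_mem (by exact hxy), abs_of_pos (Real.exp_pos _),
        ← Real.exp_add]
      refine Real.exp_le_exp.2 ?_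
      -- The primitive of an even function is odd, so the exponent P(x) + P(y) = P(x) - P(-y) is the
      -- integral of m over [-y, x], an interval of length x + y.
      have h1 := hlow (-y) x (by linarith)
      rw [← primitive_sub hm.continuous, primitive_neg_of_even hm.even] at h1
      linarith
    · rw [greenKernel, if_neg hxy, Set.indicator_of_notMem (by exact hxy), abs_zero]
  · rw [integrable_indicator_iff measurableSet_Ioi]
    exact (exp_neg_integrableOn_Ioi 0 hb).const_mul _
  · rw [memLp_indicator_iff_restrict measurableSet_Ioi, memLp_two_iff_integrable_sq]
    · have := (exp_neg_integrableOn_Ioi 0 (show 0 < 2 * b by linarith)).const_mul (Real.exp c ^ 2)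
      refine this.congr (Filter.Eventually.of_forall fun s => ?_)
      simp only [mul_pow, ← Real.exp_nat_mul]
      congr 2
      push_cast
      ring
    · exact Continuous.aestronglyMeasurable (by fun_prop)

lemma integrable_greenKernel_mul (hm : IsConfining m) (hh : MemLp h 2 volume) (x : ℝ) :
    Integrable fun y => greenKernel m x y * h y :=
  hm.exists_isDominatedKernel.choose_spec.integrable_mul hh x

lemma memLp_green (hm : IsConfining m) (hh : MemLp h 2 volume) : MemLp (green m h) 2 volume :=
  hm.exists_isDominatedKernel.choose_spec.memLp hh

lemma integral_green_mul (hm : IsConfining m) (hh : MemLp h 2 volume) (hg : MemLp g 2 volume) :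
    ∫ x, green m h x * g x = ∫ x, h x * green m g x :=
  hm.exists_isDominatedKernel.choose_spec.integral_symm (greenKernel_comm m) hh hg

/-- The function m η - η' is the formal adjoint of f' + m f applied to η, and exp(-P)(m η - η') is
minus the derivative of exp(-P) η; only the boundary term at -y survives, and oddness of P cancels
the exponentials. -/
lemma green_test (hm : IsConfining m) {η : ℝ → ℝ} (h1 : ContDiff ℝ 1 η)
    (h2 : HasCompactSupport η) (y : ℝ) : green m (fun x => m x * η x - deriv η x) y = η (-y) := by
  have hd : ∀ x, deriv (fun x => Real.exp (-primitive m x) * η x) x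
      = -(Real.exp (-primitive m x) * (m x * η x - deriv η x)) := fun x => by
    have := (hasDerivAt_primitive hm.continuous x).neg.exp.mul
      (h1.differentiable one_ne_zero x).hasDerivAt
    refine (this.deriv).trans ?_
    simp only [Pi.neg_apply]
    ring
  have hc : ContDiff ℝ 1 fun x => Real.exp (-primitive m x) * η x :=
    (contDiff_primitive hm.continuous).neg.exp.mul h1
  have e := HasCompactSupport.integral_Ioi_deriv_eq hc h2.mul_left (-y)
  simp_rw [hd, integral_neg] at e
  rw [green_eq, neg_inj.1 e, ← mul_assoc, ← Real.exp_add, primitive_neg_of_even hm.even]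
  simp

/-- Symmetry moves `green m` onto the adjoint expression m η - η', where `green_test` evaluates it.
No regularity of h is needed. -/
lemma isWeakDeriv_green (hm : IsConfining m) (hh : MemLp h 2 volume) :
    IsWeakDeriv (green m h) fun x => h (-x) - m x * green m h x := by
  intro η h1 h2
  have h1' : ContDiff ℝ 1 η := h1.of_le (by norm_cast)
  have cd : Continuous (deriv η) := h1.continuous_deriv (by simp)
  have cξ : Continuous fun x => m x * η x - deriv η x := (hm.continuous.mul h1.continuous).sub cd
  have hξ : MemLp (fun x => m x * η x - deriv η x) 2 volume :=
    cξ.memLp_of_hasCompactSupport (h2.mul_left.sub h2.deriv)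
  have hB := hm.memLp_green hh
  have e := hm.integral_green_mul hh hξ
  simp_rw [hm.green_test h1' h2] at e
  have i1 := integrable_continuous_mul (hm.continuous.mul h1.continuous) h2.mul_left hB
  have i2 := integrable_continuous_mul cd h2.deriv hB
  have hr : MemLp (fun x => h (-x)) 2 volume :=
    hh.comp_measurePreserving (Measure.measurePreserving_neg volume)
  have i3 := integrable_continuous_mul h1.continuous h2 hr
  simp only [Pi.mul_apply] at i1
  have e1 : ∫ x, green m h x * (m x * η x - deriv η x)
      = (∫ x, m x * η x * green m h x) - ∫ x, deriv η x * green m h x := by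
    rw [← integral_sub i1 i2]
    refine integral_congr_ae (Filter.Eventually.of_forall fun x => ?_)
    simp only
    ring
  have e2 : ∫ x, η x * (h (-x) - m x * green m h x)
      = (∫ x, η x * h (-x)) - ∫ x, m x * η x * green m h x := by
    rw [← integral_sub i3 i1]
    refine integral_congr_ae (Filter.Eventually.of_forall fun x => ?_)
    simp only
    ring
  have e3 : ∫ x, h x * η (-x) = ∫ x, η x * h (-x) := by
    rw [← integral_neg_eq_self]
    simp only [neg_neg, mul_comm]
  rw [e2]
  linarith

/-- The equation `z' = -m z` has no nonzero square integrable solution. -/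
lemma ae_eq_zero_of_isWeakDeriv (hm : IsConfining m) {z : ℝ → ℝ} (hz : MemLp z 2 volume)
    (hz' : MemLp (fun x => -(m x * z x)) 2 volume) (hw : IsWeakDeriv z fun x => -(m x * z x)) :
    z =ᵐ[volume] 0 := by
  refine ae_eq_zero_of_integral_contDiff_smul_eq_zero (hz.locallyIntegrable (by norm_num)) ?_
  intro η h1 h2
  simp only [smul_eq_mul]
  have hη2 : MemLp η 2 volume := h1.continuous.memLp_of_hasCompactSupport h2
  obtain ⟨R, hR⟩ : ∃ R, ∀ x, R < |x| → η x = 0 := by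
    obtain ⟨R, hR⟩ := h2.isCompact.isBounded.subset_closedBall 0
    refine ⟨R, fun x hx => ?_⟩
    by_contra hne
    have := hR (subset_tsupport _ hne)
    rw [Metric.mem_closedBall, Real.dist_eq, sub_zero] at this
    linarith
  -- A duality argument: ψ is a square integrable C¹ solution of the adjoint equation ψ' = m ψ - η.
  -- Testing the equation for z with ψ should give ∫ η z = 0, but ψ lacks compact support.
  set ψ : ℝ → ℝ := fun x => green m η (-x) with hψ
  have hψ2 : MemLp ψ 2 volume :=
    (hm.memLp_green hη2).comp_measurePreserving (Measure.measurePreserving_neg volume)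
  have cI : Continuous fun y => Real.exp (-primitive m y) * η y :=
    (continuous_primitive hm.continuous).neg.rexp.mul h1.continuous
  have hint : Integrable fun y => Real.exp (-primitive m y) * η y :=
    cI.integrable_of_hasCompactSupport h2.mul_left
  have hψe : ∀ x, ψ x = Real.exp (primitive m x)
      * ((∫ y in Set.Ioi 0, Real.exp (-primitive m y) * η y)
        - primitive (fun y => Real.exp (-primitive m y) * η y) x) := by
    intro x
    rw [hψ]
    simp only
    rw [green_eq, primitive_neg_of_even hm.even, neg_neg, neg_neg]
    congr 1
    rw [primitive, eq_sub_iff_add_eq, add_comm]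
    exact intervalIntegral.integral_interval_add_Ioi hint.integrableOn hint.integrableOn
  have hψd : ∀ x, HasDerivAt ψ (m x * ψ x - η x) x := by
    intro x
    have := (hasDerivAt_primitive hm.continuous x).exp.mul
      ((hasDerivAt_primitive cI x).const_sub
        (∫ y in Set.Ioi 0, Real.exp (-primitive m y) * η y))
    rw [funext hψe]
    refine this.congr_deriv ?_
    have : Real.exp (primitive m x) * Real.exp (-primitive m x) = 1 := by
      rw [← Real.exp_add]; simp
    linear_combination (-η x) * this
  have hψc : Continuous ψ := continuous_iff_continuousAt.2 fun x => (hψd x).continuousAt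
  have hψ1 : ContDiff ℝ 1 ψ := by
    rw [contDiff_one_iff_deriv]
    refine ⟨fun x => (hψd x).differentiableAt, ?_⟩
    rw [funext fun x => (hψd x).deriv]
    exact (hm.continuous.mul hψc).sub h1.continuous
  -- The rescaled cutoff χ(x/(n + 1)) equals 1 on the support of η once n ≥ R; the only error comes
  -- from its derivative and is O(1/(n + 1)), because ψ z is integrable.
  let χ : ContDiffBump (0 : ℝ) := ⟨1, 2, one_pos, one_lt_two⟩
  have hχ : ContDiff ℝ ∞ χ := χ.contDiff
  obtain ⟨M, hM⟩ := χ.hasCompactSupport.deriv.exists_bound_of_continuous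
    (hχ.continuous_deriv (by simp))
  have hzψ : Integrable fun x => |ψ x * z x| := (hψ2.integrable_mul hz).abs
  have key : ∀ n : ℕ, R ≤ n → |∫ x, η x * z x| ≤ M * (∫ x, |ψ x * z x|) * (1 / ((n : ℝ) + 1)) := by
    intro n hn
    have hn0 : (0 : ℝ) < (n : ℝ) + 1 := by positivity
    set c : ℝ := 1 / ((n : ℝ) + 1) with hc
    have hc0 : 0 < c := by positivity
    have h3 : ContDiff ℝ 1 fun x => χ (c * x) :=
      (hχ.of_le (by norm_cast)).comp (contDiff_const.mul contDiff_id)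
    have h4 : HasCompactSupport fun x => χ (c * x) :=
      χ.hasCompactSupport.comp_homeomorph (Homeomorph.mulLeft₀ c hc0.ne')
    have hd : ∀ x, deriv (fun x => χ (c * x) * ψ x) x
        = c * (deriv χ (c * x) * ψ x) + χ (c * x) * (m x * ψ x) - η x := by
      intro x
      have e1 : HasDerivAt (fun x => χ (c * x)) (deriv χ (c * x) * c) x := by
        have := (hχ.differentiable (by simp) (c * x)).hasDerivAt.comp x
          ((hasDerivAt_id x).const_mul c)
        simpa only [id, mul_one, Function.comp_def] using this
      have e2 : χ (c * x) * η x = η x := by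
        by_cases hx : R < |x|
        · rw [hR x hx, mul_zero]
        · rw [χ.one_of_mem_closedBall, one_mul]
          rw [Metric.mem_closedBall, dist_zero_right, Real.norm_eq_abs, abs_mul, abs_of_pos hc0, hc,
            one_div, inv_mul_le_iff₀ hn0]
          change |x| ≤ (n + 1) * 1
          linarith
      refine (e1.mul (hψd x)).deriv.trans ?_
      linear_combination (-1 : ℝ) * e2
    have e := hw.integral_deriv_mul hz hz' (h3.mul hψ1) h4.mul_right
    simp only [hd] at e
    have cχ : Continuous fun x => χ (c * x) := h3.continuous
    have i1 : Integrable fun x => χ (c * x) * (m x * ψ x) * z x := by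
      refine integrable_continuous_mul (cχ.mul (hm.continuous.mul hψc)) h4.mul_right hz
    have i2 : Integrable fun x => η x * z x := integrable_continuous_mul h1.continuous h2 hz
    have i3 : Integrable fun x => deriv χ (c * x) * ψ x * z x := by
      refine integrable_continuous_mul (((hχ.continuous_deriv (by simp)).comp
        (continuous_const.mul continuous_id)).mul hψc) ?_ hz
      exact (χ.hasCompactSupport.deriv.comp_homeomorph
        (Homeomorph.mulLeft₀ c hc0.ne')).mul_right
    have e3 : ∫ x, (c * (deriv χ (c * x) * ψ x) + χ (c * x) * (m x * ψ x) - η x) * z x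
        = c * (∫ x, deriv χ (c * x) * ψ x * z x) + (∫ x, χ (c * x) * (m x * ψ x) * z x)
          - ∫ x, η x * z x := by
      have i13 : Integrable fun x => c * (deriv χ (c * x) * ψ x * z x)
          + χ (c * x) * (m x * ψ x) * z x := (i3.const_mul c).add i1
      rw [← integral_const_mul, ← integral_add (i3.const_mul c) i1, ← integral_sub i13 i2]
      refine integral_congr_ae (Filter.Eventually.of_forall fun x => ?_)
      simp only
      ring
    have e4 : ∫ x, χ (c * x) * ψ x * -(m x * z x) = -∫ x, χ (c * x) * (m x * ψ x) * z x := by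
      rw [← integral_neg]
      refine integral_congr_ae (Filter.Eventually.of_forall fun x => ?_)
      simp only
      ring
    rw [e3, e4] at e
    have e5 : ∫ x, η x * z x = c * ∫ x, deriv χ (c * x) * ψ x * z x := by linarith
    rw [e5, abs_mul, abs_of_pos hc0, mul_comm]
    refine mul_le_mul_of_nonneg_right ?_ hc0.le
    rw [← integral_const_mul, ← Real.norm_eq_abs]
    refine norm_integral_le_of_norm_le (hzψ.const_mul M) (Filter.Eventually.of_forall fun x => ?_)
    rw [mul_assoc, norm_mul]
    exact mul_le_mul_of_nonneg_right (hM _) (norm_nonneg _)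
  have hlim : Filter.Tendsto (fun n : ℕ => M * (∫ x, |ψ x * z x|) * (1 / ((n : ℝ) + 1)))
      Filter.atTop (nhds 0) := by
    simpa using tendsto_one_div_add_atTop_nhds_zero_nat.const_mul (M * ∫ x, |ψ x * z x|)
  have h0 : |∫ x, η x * z x| ≤ 0 := by
    refine ge_of_tendsto hlim ?_
    obtain ⟨N, hN⟩ := exists_nat_ge R
    filter_upwards [Filter.eventually_ge_atTop N] with n hn
    exact key n (hN.trans (by exact_mod_cast hn))
  exact abs_nonpos_iff.1 h0

/-- `green m h` is the only square integrable solution of `f' + m f = h ∘ (- ·)`. -/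
lemma ae_eq_green (hm : IsConfining m) {f : ℝ → ℝ} {M : ℝ} (hM : ∀ x, |m x| ≤ M)
    (hf : MemLp f 2 volume) (hh : MemLp h 2 volume)
    (hw : IsWeakDeriv f fun x => h (-x) - m x * f x) : f =ᵐ[volume] green m h := by
  have hmul : ∀ u : ℝ → ℝ, MemLp u 2 volume → MemLp (fun x => m x * u x) 2 volume := by
    intro u hu
    refine hu.of_le_mul (c := M) (hm.continuous.aestronglyMeasurable.mul hu.1) ?_
    filter_upwards with x
    rw [norm_mul]
    exact mul_le_mul_of_nonneg_right (hM x) (norm_nonneg _)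
  have hB := hm.memLp_green hh
  have hr : MemLp (fun x => h (-x)) 2 volume :=
    hh.comp_measurePreserving (Measure.measurePreserving_neg volume)
  have hd := hw.sub (hm.isWeakDeriv_green hh) hf (hr.sub (hmul f hf)) hB (hr.sub (hmul _ hB))
  have e : (fun x => h (-x) - m x * f x - (h (-x) - m x * green m h x))
      = fun x => -(m x * (f x - green m h x)) := by
    funext x; ring
  rw [e] at hd
  have := hm.ae_eq_zero_of_isWeakDeriv (hf.sub hB) (hmul _ (hf.sub hB)).neg hd
  filter_upwards [this] with x hx
  exact sub_eq_zero.1 hx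

end IsConfining

/-! ### The Green operator on the real Hilbert space -/

/-- The real Hilbert space `L²(ℝ; ℝ)`. -/
abbrev RealL2 : Type := Lp ℝ 2 (volume : Measure ℝ)

lemma inner_toLp {f g : ℝ → ℝ} (hf : MemLp f 2 volume) (hg : MemLp g 2 volume) :
    inner ℝ (hf.toLp f : RealL2) (hg.toLp g) = ∫ x, f x * g x := by
  rw [L2.inner_def]
  refine integral_congr_ae ?_
  filter_upwards [hf.coeFn_toLp, hg.coeFn_toLp] with x h1 h2
  rw [h1, h2, real_inner_eq_re_inner]
  simp [mul_comm]

lemma norm_sq_toLp {f : ℝ → ℝ} (hf : MemLp f 2 volume) :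
    ‖(hf.toLp f : RealL2)‖ ^ 2 = ∫ x, f x ^ 2 := by
  rw [← real_inner_self_eq_norm_sq, inner_toLp hf hf]
  simp only [sq]

lemma sq_integral_mul_le {f g : ℝ → ℝ} (hf : MemLp f 2 volume) (hg : MemLp g 2 volume) :
    (∫ x, f x * g x) ^ 2 ≤ (∫ x, f x ^ 2) * ∫ x, g x ^ 2 := by
  rw [← inner_toLp hf hg, ← norm_sq_toLp hf, ← norm_sq_toLp hg, ← mul_pow, ← sq_abs]
  exact pow_le_pow_left₀ (abs_nonneg _) (abs_real_inner_le_norm _ _) 2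

namespace IsConfining

variable {m : ℝ → ℝ}

/-- The integral operator `green m` on `L²(ℝ; ℝ)`. -/
def greenOp (hm : IsConfining m) : RealL2 →ₗ[ℝ] RealL2 where
  toFun h := (hm.memLp_green (Lp.memLp h)).toLp (green m h)
  map_add' h g := by
    rw [← MemLp.toLp_add, MemLp.toLp_eq_toLp_iff]
    refine Filter.Eventually.of_forall fun x => ?_
    rw [Pi.add_apply, green, green, green,
      ← integral_add (hm.integrable_greenKernel_mul (Lp.memLp h) x)
        (hm.integrable_greenKernel_mul (Lp.memLp g) x)]
    refine integral_congr_ae ?_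
    filter_upwards [Lp.coeFn_add h g] with y hy
    rw [hy, Pi.add_apply, mul_add]
  map_smul' c h := by
    rw [RingHom.id_apply, ← MemLp.toLp_const_smul, MemLp.toLp_eq_toLp_iff]
    refine Filter.Eventually.of_forall fun x => ?_
    rw [Pi.smul_apply, green, green, smul_eq_mul, ← integral_const_mul]
    refine integral_congr_ae ?_
    filter_upwards [Lp.coeFn_smul c h] with y hy
    rw [hy, Pi.smul_apply, smul_eq_mul, mul_left_comm]

lemma greenOp_apply (hm : IsConfining m) (h : RealL2) :
    hm.greenOp h = (hm.memLp_green (Lp.memLp h)).toLp (green m h) := rfl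

lemma greenOp_toLp (hm : IsConfining m) {h : ℝ → ℝ} (hh : MemLp h 2 volume) :
    hm.greenOp (hh.toLp h) = (hm.memLp_green hh).toLp (green m h) := by
  rw [greenOp_apply, MemLp.toLp_eq_toLp_iff]
  refine Filter.Eventually.of_forall fun x => integral_congr_ae ?_
  filter_upwards [hh.coeFn_toLp] with y hy
  rw [hy]

lemma greenOp_symm (hm : IsConfining m) (f g : RealL2) :
    inner ℝ (hm.greenOp f) g = inner ℝ f (hm.greenOp g) := by
  have h := hm.integral_green_mul (Lp.memLp f) (Lp.memLp g)
  rw [← inner_toLp (hm.memLp_green (Lp.memLp f)) (Lp.memLp g),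
    ← inner_toLp (Lp.memLp f) (hm.memLp_green (Lp.memLp g)), Lp.toLp_coeFn, Lp.toLp_coeFn] at h
  exact h

end IsConfining

/-! ### Domain walls and the two wall mass -/

lemma isConfining_of_eq_const {m : ℝ → ℝ} {b R : ℝ} (hm : Continuous m) (he : Function.Even m)
    (hb : 0 < b) (hR : ∀ x, R ≤ |x| → m x = b) : IsConfining m := by
  -- The deviation b - m has compact support, so its total mass bounds the loss on every interval at
  -- once.
  refine ⟨hm, he, b, ∫ x, |b - m x|, hb, fun s t hst => ?_⟩
  have hi : Integrable fun x => |b - m x| := by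
    refine Integrable.abs (Continuous.integrable_of_hasCompactSupport (by fun_prop) ?_)
    refine HasCompactSupport.intro (isCompact_Icc (a := -R) (b := R)) fun x hx => ?_
    rw [Set.mem_Icc, ← abs_le, not_le] at hx
    rw [hR x hx.le, sub_self]
  have h1 : ∫ y in s..t, (b - m y) ≤ ∫ x, |b - m x| := by
    rw [intervalIntegral.integral_of_le hst]
    refine le_trans ?_ (setIntegral_le_integral (s := Set.Ioc s t) hi
      (Filter.Eventually.of_forall fun x => abs_nonneg _))
    refine setIntegral_mono_on ?_ hi.integrableOn measurableSet_Ioc fun x _ => le_abs_self _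
    exact (Continuous.integrableOn_Ioc (by fun_prop))
  rw [intervalIntegral.integral_sub (by simp) (hm.intervalIntegrable _ _),
    intervalIntegral.integral_const, smul_eq_mul] at h1
  linarith

namespace IsDomainWall

variable {κ : ℝ → ℝ} {κinf : ℝ}

lemma continuous (hκ : IsDomainWall κ κinf) : Continuous κ := hκ.contDiff.continuous

lemma exists_abs_le (hκ : IsDomainWall κ κinf) : ∃ M, ∀ x, |κ x| ≤ M := by
  obtain ⟨M, hM⟩ := (isCompact_Icc (a := (-1 : ℝ)) (b := 1)).exists_bound_of_continuousOn
    hκ.continuous.continuousOn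
  refine ⟨max M κinf, fun x => ?_⟩
  by_cases h1 : 1 ≤ x
  · rw [hκ.eq_of_one_le x h1, abs_of_pos hκ.pos]
    exact le_max_right _ _
  by_cases h2 : x ≤ -1
  · rw [hκ.eq_of_le_neg_one x h2, abs_neg, abs_of_pos hκ.pos]
    exact le_max_right _ _
  · exact (hM x ⟨by linarith, by linarith⟩).trans (le_max_left _ _)

lemma abs_primitive_le {M : ℝ} (hM : ∀ x, |κ x| ≤ M) (x : ℝ) : |primitive κ x| ≤ M * |x| := by
  have := intervalIntegral.norm_integral_le_of_norm_le_const (a := 0) (b := x) (f := κ) (C := M)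
    fun y _ => hM y
  rwa [sub_zero] at this

/-- The primitive of the odd function κ is even, so a half line suffices; beyond 1 its slope is
κinf, and the constant pays for the interval [0, 1]. -/
lemma exists_le_primitive (hκ : IsDomainWall κ κinf) :
    ∃ c, 0 ≤ c ∧ ∀ x, κinf * |x| - c ≤ primitive κ x := by
  obtain ⟨M, hM⟩ := hκ.exists_abs_le
  have hM0 : 0 ≤ M := (abs_nonneg _).trans (hM 0)
  have hpos := hκ.pos
  have key : ∀ x, 0 ≤ x → κinf * x - (κinf + M) ≤ primitive κ x := by
    intro x hx
    rcases le_total x 1 with h | h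
    · have h1 := neg_le_of_abs_le (abs_primitive_le hM x)
      rw [abs_of_nonneg hx] at h1
      nlinarith
    · have h1 := neg_le_of_abs_le (abs_primitive_le hM 1)
      rw [abs_one] at h1
      have h2 := primitive_sub hκ.continuous 1 x
      have h3 : ∫ y in (1 : ℝ)..x, κ y = ∫ y in (1 : ℝ)..x, κinf := by
        refine intervalIntegral.integral_congr fun y hy => ?_
        rw [Set.uIcc_of_le h] at hy
        exact hκ.eq_of_one_le y hy.1
      rw [h3, intervalIntegral.integral_const, smul_eq_mul] at h2
      linarith
  refine ⟨κinf + M, by linarith, fun x => ?_⟩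
  rcases le_total 0 x with h | h
  · rw [abs_of_nonneg h]; exact key x h
  · rw [abs_of_nonpos h, ← primitive_neg_of_odd hκ.odd]; exact key (-x) (by linarith)

lemma twoWall_of_nonneg (hκ : IsDomainWall κ κinf) {δ x : ℝ} (hx : 0 ≤ x) :
    twoWall κ δ x = κ (x - δ) := by
  rw [twoWall]
  split_ifs with h
  · have : x = 0 := le_antisymm h hx
    rw [this, zero_add, zero_sub, hκ.odd]
  · rfl

lemma twoWall_of_nonpos {δ x : ℝ} (hx : x ≤ 0) : twoWall κ δ x = -κ (x + δ) := if_pos hx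

lemma even_twoWall (hκ : IsDomainWall κ κinf) (δ : ℝ) : Function.Even (twoWall κ δ) := by
  have key : ∀ x, 0 ≤ x → twoWall κ δ (-x) = twoWall κ δ x := fun x hx => by
    rw [hκ.twoWall_of_nonneg hx, twoWall_of_nonpos (by linarith), ← hκ.odd]
    congr 1
    ring
  intro x
  rcases le_total 0 x with h | h
  · exact key x h
  · have := key (-x) (by linarith)
    rw [neg_neg] at this
    exact this.symm

lemma continuous_twoWall (hκ : IsDomainWall κ κinf) (δ : ℝ) : Continuous (twoWall κ δ) := by
  have hc := hκ.continuous
  refine Continuous.if_le (by fun_prop) (by fun_prop) continuous_id continuous_const ?_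
  intro x hx
  rw [hx, zero_add, zero_sub, hκ.odd]

lemma abs_twoWall_le {M : ℝ} (hM : ∀ x, |κ x| ≤ M) (δ x : ℝ) : |twoWall κ δ x| ≤ M := by
  rw [twoWall]
  split_ifs
  · rw [abs_neg]; exact hM _
  · exact hM _

lemma isConfining_twoWall (hκ : IsDomainWall κ κinf) (δ : ℝ) :
    IsConfining (twoWall κ δ) := by
  refine isConfining_of_eq_const (R := δ + 1) (hκ.continuous_twoWall δ) (hκ.even_twoWall δ)
    hκ.pos fun x hx => ?_
  rcases le_total 0 x with h | h
  · rw [abs_of_nonneg h] at hx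
    rw [hκ.twoWall_of_nonneg h, hκ.eq_of_one_le _ (by linarith)]
  · rw [abs_of_nonpos h] at hx
    rw [twoWall_of_nonpos h, hκ.eq_of_le_neg_one _ (by linarith), neg_neg]

end IsDomainWall

/-! ### The profile of the zero mode: normalization and tails -/

lemma integrable_exp_neg_mul_abs {b : ℝ} (hb : 0 < b) :
    Integrable fun x : ℝ => Real.exp (-(b * |x|)) := by
  have h1 : IntegrableOn (fun x : ℝ => Real.exp (-(b * |x|))) (Set.Iic 0) := by
    refine (integrableOn_exp_mul_Iic hb 0).congr_fun (fun x hx => ?_) measurableSet_Iic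
    rw [abs_of_nonpos hx, mul_neg, neg_neg]
  have h2 : IntegrableOn (fun x : ℝ => Real.exp (-(b * |x|))) (Set.Ioi 0) := by
    refine (exp_neg_integrableOn_Ioi 0 hb).congr_fun (fun x hx => ?_) measurableSet_Ioi
    simp only [abs_of_pos hx.out, neg_mul]
  rw [← integrableOn_univ, ← Set.Iic_union_Ioi (a := (0 : ℝ))]
  exact h1.union h2

/-- The normalized profile of the zero mode. -/
def profile (κ : ℝ → ℝ) (x : ℝ) : ℝ := √2 * gammaConst κ * Real.exp (-primitive κ x)

namespace IsDomainWall

variable {κ : ℝ → ℝ} {κinf : ℝ}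

lemma memLp_exp_neg_primitive (hκ : IsDomainWall κ κinf) :
    MemLp (fun x => Real.exp (-primitive κ x)) 2 volume := by
  have hc : Continuous fun x => Real.exp (-primitive κ x) :=
    (continuous_primitive hκ.continuous).neg.rexp
  obtain ⟨c, -, hcl⟩ := hκ.exists_le_primitive
  rw [memLp_two_iff_integrable_sq hc.aestronglyMeasurable]
  have hi := (integrable_exp_neg_mul_abs (show 0 < 2 * κinf by linarith [hκ.pos])).const_mul
    (Real.exp (2 * c))
  refine hi.mono' (hc.pow 2).aestronglyMeasurable (Filter.Eventually.of_forall fun x => ?_)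
  rw [Real.norm_eq_abs, abs_of_nonneg (sq_nonneg _), ← Real.exp_nat_mul, ← Real.exp_add]
  refine Real.exp_le_exp.2 ?_
  have := hcl x
  push_cast
  linarith

lemma memLp_profile (hκ : IsDomainWall κ κinf) : MemLp (profile κ) 2 volume :=
  hκ.memLp_exp_neg_primitive.const_mul _

lemma integral_exp_sq_pos (hκ : IsDomainWall κ κinf) :
    0 < ∫ x, Real.exp (-primitive κ x) ^ 2 := by
  have hc : Continuous fun x => Real.exp (-primitive κ x) ^ 2 :=
    (continuous_primitive hκ.continuous).neg.rexp.pow 2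
  exact integral_pos_of_integrable_nonneg_nonzero (x := 0) hc
    hκ.memLp_exp_neg_primitive.integrable_sq (fun x => sq_nonneg _) (by positivity)

lemma sq_gammaConst (hκ : IsDomainWall κ κinf) :
    2 * gammaConst κ ^ 2 * ∫ x, Real.exp (-primitive κ x) ^ 2 = 1 := by
  have hp := hκ.integral_exp_sq_pos
  have h := norm_sq_toLp hκ.memLp_exp_neg_primitive
  rw [Lp.norm_toLp] at h
  rw [← h] at hp ⊢
  have e : gammaConst κ = 1 / (√2 * (eLpNorm (fun x => Real.exp (-primitive κ x)) 2 volume).toReal) :=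
    rfl
  have hne : (eLpNorm (fun x => Real.exp (-primitive κ x)) 2 volume).toReal ≠ 0 := by
    intro h0
    rw [h0] at hp
    norm_num at hp
  rw [e, div_pow, mul_pow, Real.sq_sqrt (by norm_num)]
  field_simp

lemma gammaConst_pos (hκ : IsDomainWall κ κinf) : 0 < gammaConst κ := by
  have h0 : 0 ≤ gammaConst κ := by rw [gammaConst]; positivity
  refine lt_of_le_of_ne h0 fun h => ?_
  have := hκ.sq_gammaConst
  rw [← h] at this
  simp at this

lemma profile_pos (hκ : IsDomainWall κ κinf) (x : ℝ) : 0 < profile κ x := by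
  have := hκ.gammaConst_pos
  rw [profile]
  positivity

lemma profile_neg (hκ : IsDomainWall κ κinf) (x : ℝ) : profile κ (-x) = profile κ x := by
  rw [profile, profile, primitive_neg_of_odd hκ.odd]

lemma integral_profile_sq (hκ : IsDomainWall κ κinf) : ∫ x, profile κ x ^ 2 = 1 := by
  simp only [profile, mul_pow, integral_const_mul]
  rw [Real.sq_sqrt (by norm_num)]
  exact hκ.sq_gammaConst

/-- This tail bound is used twice: at s = 2 - 2δ it measures the truncation of the quasimode, at s =
-δ/2 the overlap error in the gap estimate. -/
lemma exists_integral_Iic_profile_sq_le (hκ : IsDomainWall κ κinf) :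
    ∃ C, 0 < C ∧ ∀ s, ∫ x in Set.Iic s, profile κ x ^ 2 ≤ C * Real.exp (2 * κinf * s) := by
  obtain ⟨c, -, hcl⟩ := hκ.exists_le_primitive
  have hpos := hκ.pos
  have hγ := hκ.gammaConst_pos
  have hb : 0 < 2 * κinf := by linarith
  refine ⟨2 * gammaConst κ ^ 2 * Real.exp (2 * c) / (2 * κinf), by positivity, fun s => ?_⟩
  have hle : ∀ x, profile κ x ^ 2
      ≤ 2 * gammaConst κ ^ 2 * Real.exp (2 * c) * Real.exp (2 * κinf * x) := by
    intro x
    rw [profile, mul_pow, mul_pow, Real.sq_sqrt (by norm_num), mul_assoc _ (Real.exp (2 * c)),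
      ← Real.exp_add, ← Real.exp_nat_mul]
    refine mul_le_mul_of_nonneg_left (Real.exp_le_exp.2 ?_) (by positivity)
    have h1 := hcl x
    have h2 := mul_le_mul_of_nonneg_left (neg_abs_le x) hpos.le
    push_cast
    linarith
  have hi : IntegrableOn (fun x => Real.exp (2 * κinf * x)) (Set.Iic s) :=
    integrableOn_exp_mul_Iic hb s
  refine (setIntegral_mono_on hκ.memLp_profile.integrable_sq.integrableOn (hi.const_mul _)
    measurableSet_Iic fun x _ => hle x).trans ?_
  rw [integral_const_mul, integral_exp_mul_Iic hb]
  apply le_of_eq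
  ring

end IsDomainWall

/-! ### Spinor directions and the scalar form of the spectral gap -/

/-- The spinor direction of the zero mode. -/
def spinorR : Spinor := !₂[1, Complex.I]

/-- The spinor direction orthogonal to the zero mode. -/
def spinorL : Spinor := !₂[1, -Complex.I]

lemma norm_sq_spinorR : ‖spinorR‖ ^ 2 = 2 := by
  rw [spinorR, EuclideanSpace.norm_sq_eq, Fin.sum_univ_two]
  norm_num

lemma norm_sq_spinorL : ‖spinorL‖ ^ 2 = 2 := by
  rw [spinorL, EuclideanSpace.norm_sq_eq, Fin.sum_univ_two]
  norm_num

lemma inner_spinorR_self : inner ℂ spinorR spinorR = 2 := by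
  rw [inner_self_eq_norm_sq_to_K, ← RCLike.ofReal_pow, norm_sq_spinorR]
  simp

lemma inner_spinorR_spinorL : inner ℂ spinorR spinorL = 0 := by
  simp [spinorR, spinorL, PiLp.inner_apply, Fin.sum_univ_two]

lemma memLp_smul_spinor {f : ℝ → ℝ} (hf : MemLp f 2 volume) (e : Spinor) :
    MemLp (fun x => f x • e) 2 volume :=
  (ContinuousLinearMap.toSpanSingleton ℝ e).comp_memLp' hf

/-- The spinor field `f e` for a square integrable real function `f` and a fixed spinor `e`. -/
def spinorField {f : ℝ → ℝ} (hf : MemLp f 2 volume) (e : Spinor) : H :=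
  (memLp_smul_spinor hf e).toLp _

lemma coeFn_spinorField {f : ℝ → ℝ} (hf : MemLp f 2 volume) (e : Spinor) :
    ∀ᵐ x, spinorField hf e x = f x • e :=
  (memLp_smul_spinor hf e).coeFn_toLp

lemma norm_sq_eq_integral (F : H) : ‖F‖ ^ 2 = ∫ x, ‖F x‖ ^ 2 := by
  rw [← inner_self_eq_norm_sq (𝕜 := ℂ), L2.inner_def, ← integral_re (L2.integrable_inner F F)]
  refine integral_congr_ae (Filter.Eventually.of_forall fun x => ?_)
  exact inner_self_eq_norm_sq (𝕜 := ℂ) (F x)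

lemma norm_sq_spinorField {f : ℝ → ℝ} (hf : MemLp f 2 volume) (e : Spinor) :
    ‖spinorField hf e‖ ^ 2 = ‖e‖ ^ 2 * ∫ x, f x ^ 2 := by
  rw [norm_sq_eq_integral, ← integral_const_mul]
  refine integral_congr_ae ?_
  filter_upwards [coeFn_spinorField hf e] with x hx
  rw [hx, norm_smul, mul_pow, Real.norm_eq_abs, sq_abs, mul_comm]

lemma hasWeakDeriv_spinorField {f f' : ℝ → ℝ} (hf : MemLp f 2 volume) (hf' : MemLp f' 2 volume)
    (hw : IsWeakDeriv f f') (e : Spinor) :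
    HasWeakDeriv (spinorField hf e) (spinorField hf' e) := by
  have key : ∀ (φ u : ℝ → ℝ) (hu : MemLp u 2 volume),
      ∫ x, φ x • spinorField hu e x = (∫ x, φ x * u x) • e := by
    intro φ u hu
    rw [← integral_smul_const]
    refine integral_congr_ae ?_
    filter_upwards [coeFn_spinorField hu e] with x hx
    rw [hx, smul_smul]
  intro φ h1 h2
  rw [key, key, hw φ h1 h2, neg_smul]

lemma diracExpr_spinorR (κ : ℝ → ℝ) (F G : H) (x u u' : ℝ) (hF : F x = u • spinorR)
    (hG : G x = u' • spinorR) :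
    diracExpr κ F G x = (u' + κ x * u) • (Complex.I • spinorL) := by
  rw [diracExpr, hF, hG]
  ext i
  fin_cases i <;>
    simp [spinorR, spinorL, σ₁, σ₃, Matrix.toLpLin_apply] <;>
    ring_nf <;> simp

lemma diracExpr_spinorL (κ : ℝ → ℝ) (F G : H) (x v v' : ℝ) (hF : F x = v • spinorL)
    (hG : G x = v' • spinorL) :
    diracExpr κ F G x = (v' - κ x * v) • (Complex.I • spinorR) := by
  rw [diracExpr, hF, hG]
  ext i
  fin_cases i <;>
    simp [spinorR, spinorL, σ₁, σ₃, Matrix.toLpLin_apply] <;>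
    ring_nf <;> simp

lemma zeroMode_eq (κ : ℝ → ℝ) (x : ℝ) : zeroMode κ x = (profile κ x / √2) • spinorR := by
  have h2 : √2 ≠ 0 := by positivity
  have : profile κ x / √2 = gammaConst κ * Real.exp (-∫ y in (0 : ℝ)..x, κ y) := by
    rw [profile, primitive]
    field_simp
  rw [this]
  exact Complex.coe_smul _ _

lemma SpectralGap.norm_le {κ : ℝ → ℝ} {κinf : ℝ} (hgap : SpectralGap κ κinf) {F U : H}
    (hFU : (F, U) ∈ diracGraph κ) (h0 : ∫ x, inner ℂ (zeroMode κ x) (F x) = 0) :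
    κinf * ‖F‖ ≤ ‖U‖ := by
  rw [← dirac_graph, LinearPMap.mem_graph_iff] at hFU
  obtain ⟨y, h1, h2⟩ := hFU
  simp only at h1 h2
  have := hgap y (by rw [h1]; exact h0)
  rwa [h1, h2] at this

section Gap

variable {κ : ℝ → ℝ} {κinf : ℝ}

/-- The gap assumption for the spinor field u (1, i), which the Dirac operator maps to a field along
(1, -i). -/
lemma SpectralGap.integral_sq_le_of_orthogonal (hgap : SpectralGap κ κinf) (hpos : 0 ≤ κinf)
    {u u' : ℝ → ℝ} (hu : MemLp u 2 volume) (hu' : MemLp u' 2 volume)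
    (hk : MemLp (fun x => u' x + κ x * u x) 2 volume) (hw : IsWeakDeriv u u')
    (h0 : ∫ x, profile κ x * u x = 0) :
    κinf ^ 2 * ∫ x, u x ^ 2 ≤ ∫ x, (u' x + κ x * u x) ^ 2 := by
  have hmem : (spinorField hu spinorR, spinorField hk (Complex.I • spinorL)) ∈ diracGraph κ := by
    refine ⟨spinorField hu' spinorR, hasWeakDeriv_spinorField hu hu' hw _, ?_⟩
    filter_upwards [coeFn_spinorField hu spinorR, coeFn_spinorField hu' spinorR,
      coeFn_spinorField hk (Complex.I • spinorL)] with x h1 h2 h3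
    rw [diracExpr_spinorR κ _ _ x _ _ h1 h2]
    exact h3
  have horth : ∫ x, inner ℂ (zeroMode κ x) (spinorField hu spinorR x) = 0 := by
    have e : ∀ᵐ x, inner ℂ (zeroMode κ x) (spinorField hu spinorR x)
        = ((√2 * (profile κ x * u x) : ℝ) : ℂ) := by
      filter_upwards [coeFn_spinorField hu spinorR] with x hx
      rw [hx, zeroMode_eq, ← Complex.coe_smul, ← Complex.coe_smul, inner_smul_left,
        inner_smul_right, inner_spinorR_self, Complex.conj_ofReal]
      have h2 : √2 * √2 = 2 := Real.mul_self_sqrt (by norm_num)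
      have h3 : profile κ x / √2 * 2 = √2 * profile κ x := by
        have : √2 ≠ 0 := by positivity
        field_simp
        linear_combination (-profile κ x) * h2
      rw [← Complex.ofReal_ofNat, ← Complex.ofReal_mul, ← Complex.ofReal_mul]
      congr 1
      linear_combination u x * h3
    rw [integral_congr_ae e, integral_complex_ofReal, integral_const_mul, h0]
    simp
  have h := pow_le_pow_left₀ (by positivity) (hgap.norm_le hmem horth) 2
  rw [mul_pow, norm_sq_spinorField, norm_sq_spinorField, norm_smul, Complex.norm_I, one_mul,
    norm_sq_spinorR, norm_sq_spinorL] at h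
  linarith

/-- Fields along (1, -i) are pointwise orthogonal to the zero mode, so here the gap holds without
any condition on v. This is why the left wall contributes no second almost null vector. -/
lemma SpectralGap.integral_sq_le_left (hgap : SpectralGap κ κinf) (hpos : 0 ≤ κinf)
    {v v' : ℝ → ℝ} (hv : MemLp v 2 volume) (hv' : MemLp v' 2 volume)
    (hk : MemLp (fun x => v' x - κ x * v x) 2 volume) (hw : IsWeakDeriv v v') :
    κinf ^ 2 * ∫ x, v x ^ 2 ≤ ∫ x, (v' x - κ x * v x) ^ 2 := by
  have hmem : (spinorField hv spinorL, spinorField hk (Complex.I • spinorR)) ∈ diracGraph κ := by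
    refine ⟨spinorField hv' spinorL, hasWeakDeriv_spinorField hv hv' hw _, ?_⟩
    filter_upwards [coeFn_spinorField hv spinorL, coeFn_spinorField hv' spinorL,
      coeFn_spinorField hk (Complex.I • spinorR)] with x h1 h2 h3
    rw [diracExpr_spinorL κ _ _ x _ _ h1 h2]
    exact h3
  have horth : ∫ x, inner ℂ (zeroMode κ x) (spinorField hv spinorL x) = 0 := by
    rw [← integral_zero ℝ ℂ]
    refine integral_congr_ae ?_
    filter_upwards [coeFn_spinorField hv spinorL] with x hx
    rw [hx, zeroMode_eq, ← Complex.coe_smul, ← Complex.coe_smul, inner_smul_left,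
      inner_smul_right, inner_spinorR_spinorL, mul_zero, mul_zero]
  have h := pow_le_pow_left₀ (by positivity) (hgap.norm_le hmem horth) 2
  rw [mul_pow, norm_sq_spinorField, norm_sq_spinorField, norm_smul, Complex.norm_I, one_mul,
    norm_sq_spinorR, norm_sq_spinorL] at h
  linarith

end Gap

lemma isWeakDeriv_of_hasDerivAt {f f' : ℝ → ℝ} (hd : ∀ x, HasDerivAt f (f' x) x)
    (mf : MemLp f 2 volume) (mf' : MemLp f' 2 volume) : IsWeakDeriv f f' := by
  intro φ h1 h2
  have cd : Continuous (deriv φ) := h1.continuous_deriv (by simp)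
  have h := integral_mul_deriv_eq_deriv_mul_of_integrable (u := φ) (u' := deriv φ) (v := f)
    (v' := f') (fun x _ => (h1.differentiable (by simp) x).hasDerivAt) (fun x _ => hd x)
    (integrable_continuous_mul h1.continuous h2 mf') (integrable_continuous_mul cd h2.deriv mf)
    (integrable_continuous_mul h1.continuous h2 mf)
  linarith

lemma MemLp.bdd_continuous_mul {κ u : ℝ → ℝ} {M : ℝ} (hκ : Continuous κ) (hM : ∀ x, |κ x| ≤ M)
    (hu : MemLp u 2 volume) : MemLp (fun x => κ x * u x) 2 volume := by
  refine hu.of_le_mul (c := M) (hκ.aestronglyMeasurable.mul hu.1) ?_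
  filter_upwards with x
  rw [norm_mul]
  exact mul_le_mul_of_nonneg_right (hM x) (norm_nonneg _)

lemma memLp_comp_add {u : ℝ → ℝ} (hu : MemLp u 2 volume) (a : ℝ) :
    MemLp (fun x => u (x + a)) 2 volume :=
  hu.comp_measurePreserving (measurePreserving_add_right volume a)

lemma memLp_comp_neg {u : ℝ → ℝ} (hu : MemLp u 2 volume) : MemLp (fun x => u (-x)) 2 volume :=
  hu.comp_measurePreserving (Measure.measurePreserving_neg volume)

section Gap

variable {κ : ℝ → ℝ} {κinf : ℝ}

lemma IsDomainWall.hasDerivAt_profile (hκ : IsDomainWall κ κinf) (x : ℝ) :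
    HasDerivAt (profile κ) (-(κ x * profile κ x)) x := by
  have := (hasDerivAt_primitive hκ.continuous x).neg.exp.const_mul (√2 * gammaConst κ)
  refine this.congr_deriv ?_
  simp only [profile, Pi.neg_apply]
  ring

/-- Removing the component of u along the profile does not change u' + κ u, since the profile solves
p' = -κ p. -/
lemma SpectralGap.integral_sq_le (hgap : SpectralGap κ κinf) (hκ : IsDomainWall κ κinf)
    {u u' : ℝ → ℝ} (hu : MemLp u 2 volume) (hu' : MemLp u' 2 volume) (hw : IsWeakDeriv u u') :
    κinf ^ 2 * ((∫ x, u x ^ 2) - (∫ x, profile κ x * u x) ^ 2)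
      ≤ ∫ x, (u' x + κ x * u x) ^ 2 := by
  obtain ⟨M, hM⟩ := hκ.exists_abs_le
  have hp := hκ.memLp_profile
  have hp' : MemLp (fun x => -(κ x * profile κ x)) 2 volume :=
    (MemLp.bdd_continuous_mul hκ.continuous hM hp).neg
  set c := ∫ x, profile κ x * u x with hc
  have hv : MemLp (fun x => u x - c * profile κ x) 2 volume := hu.sub (hp.const_mul c)
  have hv' : MemLp (fun x => u' x - c * -(κ x * profile κ x)) 2 volume :=
    hu'.sub (hp'.const_mul c)
  have hwv := hw.sub ((isWeakDeriv_of_hasDerivAt hκ.hasDerivAt_profile hp hp').const_mul c)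
    hu hu' (hp.const_mul c) (hp'.const_mul c)
  have i1 : Integrable fun x => profile κ x * u x := hp.integrable_mul hu
  have horth : ∫ x, profile κ x * (u x - c * profile κ x) = 0 := by
    have e : (fun x => profile κ x * (u x - c * profile κ x))
        = fun x => profile κ x * u x - c * profile κ x ^ 2 := by funext x; ring
    rw [e, integral_sub i1 (hp.integrable_sq.const_mul c), integral_const_mul,
      hκ.integral_profile_sq, ← hc]
    ring
  have h := hgap.integral_sq_le_of_orthogonal hκ.pos.le hv hv'
    (hv'.add (MemLp.bdd_continuous_mul hκ.continuous hM hv)) hwv horth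
  have e1 : ∫ x, (u x - c * profile κ x) ^ 2 = (∫ x, u x ^ 2) - c ^ 2 := by
    have e : (fun x => (u x - c * profile κ x) ^ 2)
        = fun x => u x ^ 2 - (2 * c) * (profile κ x * u x) + c ^ 2 * profile κ x ^ 2 := by
      funext x; ring
    have i2 : Integrable fun x => u x ^ 2 - (2 * c) * (profile κ x * u x) :=
      hu.integrable_sq.sub (i1.const_mul _)
    rw [e, integral_add i2 (hp.integrable_sq.const_mul _),
      integral_sub hu.integrable_sq (i1.const_mul _), integral_const_mul, integral_const_mul,
      hκ.integral_profile_sq, ← hc]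
    ring
  have e2 : (fun x => (u' x - c * -(κ x * profile κ x) + κ x * (u x - c * profile κ x)) ^ 2)
      = fun x => (u' x + κ x * u x) ^ 2 := by funext x; ring
  rw [e1, e2] at h
  exact h

lemma SpectralGap.integral_sq_le_shift (hgap : SpectralGap κ κinf) (hκ : IsDomainWall κ κinf)
    (a : ℝ) {u u' : ℝ → ℝ} (hu : MemLp u 2 volume) (hu' : MemLp u' 2 volume)
    (hw : IsWeakDeriv u u') :
    κinf ^ 2 * ((∫ x, u x ^ 2) - (∫ x, profile κ (x - a) * u x) ^ 2)
      ≤ ∫ x, (u' x + κ (x - a) * u x) ^ 2 := by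
  have h := hgap.integral_sq_le hκ (memLp_comp_add hu a) (memLp_comp_add hu' a) (hw.comp_add a)
  rw [integral_add_right_eq_self (fun x => u x ^ 2) a] at h
  rw [← integral_add_right_eq_self (fun x => profile κ (x - a) * u x) a,
    ← integral_add_right_eq_self (fun x => (u' x + κ (x - a) * u x) ^ 2) a]
  simpa only [add_sub_cancel_right] using h

lemma SpectralGap.integral_sq_le_left_shift (hgap : SpectralGap κ κinf)
    (hκ : IsDomainWall κ κinf) (a : ℝ) {v v' : ℝ → ℝ} (hv : MemLp v 2 volume)
    (hv' : MemLp v' 2 volume) (hw : IsWeakDeriv v v') :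
    κinf ^ 2 * (∫ x, v x ^ 2) ≤ ∫ x, (v' x - κ (x + a) * v x) ^ 2 := by
  obtain ⟨M, hM⟩ := hκ.exists_abs_le
  have h := hgap.integral_sq_le_left hκ.pos.le (memLp_comp_add hv (-a))
    (memLp_comp_add hv' (-a)) ((memLp_comp_add hv' (-a)).sub
      (MemLp.bdd_continuous_mul hκ.continuous hM (memLp_comp_add hv (-a)))) (hw.comp_add (-a))
  rw [integral_add_right_eq_self (fun x => v x ^ 2) (-a)] at h
  rw [← integral_add_right_eq_self (fun x => (v' x - κ (x + a) * v x) ^ 2) (-a)]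
  simpa only [neg_add_cancel_right] using h

/-! ### Localization to a single wall -/

/-- A smooth angle that moves from `0` to `π / 2` on the scale `δ`. -/
lemma exists_angle : ∃ A : ℝ, ∀ δ : ℝ, 0 < δ → ∃ θ : ℝ → ℝ, ContDiff ℝ ∞ θ ∧
    (∀ x, x ≤ -δ / 2 → θ x = 0) ∧ (∀ x, δ / 2 ≤ x → θ x = Real.pi / 2) ∧
    (∀ x, 0 ≤ θ x) ∧ (∀ x, θ x ≤ Real.pi / 2) ∧ ∀ x, |deriv θ x| ≤ A / δ := by
  have hs : ContDiff ℝ ∞ Real.smoothTransition := Real.smoothTransition.contDiff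
  have hsc : HasCompactSupport (deriv Real.smoothTransition) := by
    refine HasCompactSupport.intro (isCompact_Icc (a := (0 : ℝ)) (b := 1)) fun x hx => ?_
    by_cases h0 : x < 0
    · have : Real.smoothTransition =ᶠ[nhds x] fun _ => 0 := by
        filter_upwards [Iio_mem_nhds h0] with y hy
        exact Real.smoothTransition.zero_of_nonpos hy.out.le
      rw [this.deriv_eq, deriv_const]
    · have h1 : 1 < x := by
        by_contra h
        exact hx ⟨not_lt.1 h0, not_lt.1 h⟩
      have : Real.smoothTransition =ᶠ[nhds x] fun _ => 1 := by
        filter_upwards [Ioi_mem_nhds h1] with y hy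
        exact Real.smoothTransition.one_of_one_le hy.out.le
      rw [this.deriv_eq, deriv_const]
  obtain ⟨A, hA⟩ := hsc.exists_bound_of_continuous (hs.continuous_deriv (by simp))
  have hπ := Real.pi_pos
  refine ⟨Real.pi / 2 * A, fun δ hδ =>
    ⟨fun x => Real.pi / 2 * Real.smoothTransition (x / δ + 1 / 2), ?_, ?_, ?_, ?_, ?_, ?_⟩⟩
  · exact contDiff_const.mul (hs.comp ((contDiff_id.div_const δ).add contDiff_const))
  · intro x hx
    beta_reduce
    rw [Real.smoothTransition.zero_of_nonpos, mul_zero]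
    have : x / δ ≤ -1 / 2 := by rw [div_le_iff₀ hδ]; linarith
    linarith
  · intro x hx
    beta_reduce
    rw [Real.smoothTransition.one_of_one_le, mul_one]
    have : 1 / 2 ≤ x / δ := by rw [le_div_iff₀ hδ]; linarith
    linarith
  · intro x
    have := Real.smoothTransition.nonneg (x / δ + 1 / 2)
    positivity
  · intro x
    have := Real.smoothTransition.le_one (x / δ + 1 / 2)
    nlinarith
  · intro x
    have hd : HasDerivAt (fun x => Real.pi / 2 * Real.smoothTransition (x / δ + 1 / 2))
        (Real.pi / 2 * (deriv Real.smoothTransition (x / δ + 1 / 2) * (1 / δ))) x := by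
      have h1 : HasDerivAt (fun x : ℝ => x / δ + 1 / 2) (1 / δ) x :=
        ((hasDerivAt_id x).div_const δ).add_const _
      exact ((hs.differentiable (by simp) (x / δ + 1 / 2)).hasDerivAt.comp x h1).const_mul _
    have h2 := hA (x / δ + 1 / 2)
    rw [Real.norm_eq_abs] at h2
    rw [hd.deriv, abs_mul, abs_mul, abs_of_pos (by positivity : 0 < Real.pi / 2),
      abs_of_pos (by positivity : 0 < 1 / δ)]
    calc Real.pi / 2 * (|deriv Real.smoothTransition (x / δ + 1 / 2)| * (1 / δ))
        ≤ Real.pi / 2 * (A * (1 / δ)) := by gcongr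
      _ = Real.pi / 2 * A / δ := by ring

/-- Localization estimate for the two wall mass: each half of `f` sees a single wall. -/
lemma SpectralGap.localization (hgap : SpectralGap κ κinf) (hκ : IsDomainWall κ κinf)
    {δ : ℝ} (hδ : 2 ≤ δ) {θ : ℝ → ℝ} {a : ℝ} (hθ : ContDiff ℝ ∞ θ)
    (hθ0 : ∀ x, x ≤ -δ / 2 → θ x = 0) (hθ1 : ∀ x, δ / 2 ≤ x → θ x = Real.pi / 2)
    (hθ' : ∀ x, |deriv θ x| ≤ a) {f f' : ℝ → ℝ} (hf : MemLp f 2 volume)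
    (hf' : MemLp f' 2 volume) (hw : IsWeakDeriv f f') :
    κinf ^ 2 * (∫ x, f x ^ 2) ≤ (∫ x, (f' x + twoWall κ δ x * f x) ^ 2) + a ^ 2 * (∫ x, f x ^ 2)
      + κinf ^ 2 * (∫ x, profile κ (x - δ) * (Real.sin (θ x) * f x)) ^ 2 := by
  obtain ⟨M, hM⟩ := hκ.exists_abs_le
  have hcθ := hθ.continuous
  have hcθ' : Continuous (deriv θ) := hθ.continuous_deriv (by simp)
  have hdθ : ∀ x, HasDerivAt θ (deriv θ x) x := fun x =>
    (hθ.differentiable (by simp) x).hasDerivAt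
  have hS : ContDiff ℝ ∞ fun x => Real.sin (θ x) := hθ.sin
  have hC : ContDiff ℝ ∞ fun x => Real.cos (θ x) := hθ.cos
  have hdS : deriv (fun x => Real.sin (θ x)) = fun x => Real.cos (θ x) * deriv θ x :=
    funext fun x => (hdθ x).sin.deriv
  have hdC : deriv (fun x => Real.cos (θ x)) = fun x => -Real.sin (θ x) * deriv θ x :=
    funext fun x => (hdθ x).cos.deriv
  have hwS := hw.smooth_mul hS hf hf'
  have hwC := hw.smooth_mul hC hf hf'
  rw [hdS] at hwS
  rw [hdC] at hwC
  have mθ : MemLp (fun x => deriv θ x * f x) 2 volume := MemLp.bdd_continuous_mul hcθ' hθ' hf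
  have mS : ∀ u : ℝ → ℝ, MemLp u 2 volume → MemLp (fun x => Real.sin (θ x) * u x) 2 volume :=
    fun u hu => MemLp.bdd_continuous_mul hS.continuous (fun x => Real.abs_sin_le_one _) hu
  have mC : ∀ u : ℝ → ℝ, MemLp u 2 volume → MemLp (fun x => Real.cos (θ x) * u x) 2 volume :=
    fun u hu => MemLp.bdd_continuous_mul hC.continuous (fun x => Real.abs_cos_le_one _) hu
  have mS' : MemLp (fun x => Real.cos (θ x) * deriv θ x * f x + Real.sin (θ x) * f' x) 2 volume := by
    simp only [mul_assoc]
    exact (mC _ mθ).add (mS _ hf')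
  have mC' : MemLp (fun x => -Real.sin (θ x) * deriv θ x * f x + Real.cos (θ x) * f' x) 2 volume := by
    simp only [mul_assoc, neg_mul]
    exact (mS _ mθ).neg.add (mC _ hf')
  have hR := hgap.integral_sq_le_shift hκ δ (mS f hf) mS' hwS
  have hL := hgap.integral_sq_le_left_shift hκ δ (mC f hf) mC' hwC
  have mk : MemLp (fun x => f' x + twoWall κ δ x * f x) 2 volume :=
    hf'.add (MemLp.bdd_continuous_mul (hκ.continuous_twoWall δ)
      (IsDomainWall.abs_twoWall_le hM δ) hf)
  -- Between -δ/2 and δ/2 both shifted walls are on their plateaus, as δ/2 ≥ 1, and agree with the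
  -- value -κinf of the two wall mass. Where sin θ or cos θ does not vanish, a single wall thus
  -- reproduces that mass.
  have eR : ∀ x, Real.sin (θ x) * κ (x - δ) = Real.sin (θ x) * twoWall κ δ x := by
    intro x
    rcases le_total 0 x with h | h
    · rw [hκ.twoWall_of_nonneg h]
    rcases le_total x (-δ / 2) with h' | h'
    · rw [hθ0 x h', Real.sin_zero, zero_mul, zero_mul]
    · rw [IsDomainWall.twoWall_of_nonpos h, hκ.eq_of_one_le (x + δ) (by linarith),
        hκ.eq_of_le_neg_one (x - δ) (by linarith)]
  have eL : ∀ x, Real.cos (θ x) * -κ (x + δ) = Real.cos (θ x) * twoWall κ δ x := by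
    intro x
    rcases le_total x 0 with h | h
    · rw [IsDomainWall.twoWall_of_nonpos h]
    rcases le_total (δ / 2) x with h' | h'
    · rw [hθ1 x h', Real.cos_pi_div_two, zero_mul, zero_mul]
    · rw [hκ.twoWall_of_nonneg h, hκ.eq_of_one_le (x + δ) (by linarith),
        hκ.eq_of_le_neg_one (x - δ) (by linarith)]
  have e1 : (∫ x, (Real.sin (θ x) * f x) ^ 2) + ∫ x, (Real.cos (θ x) * f x) ^ 2
      = ∫ x, f x ^ 2 := by
    rw [← integral_add (mS f hf).integrable_sq (mC f hf).integrable_sq]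
    refine integral_congr_ae (Filter.Eventually.of_forall fun x => ?_)
    simp only
    linear_combination f x ^ 2 * Real.sin_sq_add_cos_sq (θ x)
  -- The two integrands are the squared coordinates of the vector (θ' f, f' + m f) after a rotation
  -- by θ, so the cross terms cancel and the localization error is exactly ∫ (θ' f)².
  have e2 : (∫ x, (Real.cos (θ x) * deriv θ x * f x + Real.sin (θ x) * f' x
        + κ (x - δ) * (Real.sin (θ x) * f x)) ^ 2)
      + ∫ x, (-Real.sin (θ x) * deriv θ x * f x + Real.cos (θ x) * f' x
        - κ (x + δ) * (Real.cos (θ x) * f x)) ^ 2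
      = (∫ x, (f' x + twoWall κ δ x * f x) ^ 2) + ∫ x, (deriv θ x * f x) ^ 2 := by
    have cs : Continuous fun x => κ (x - δ) := hκ.continuous.comp (continuous_id.sub continuous_const)
    have ca : Continuous fun x => κ (x + δ) := hκ.continuous.comp (continuous_id.add continuous_const)
    have j1 := (mS'.add (MemLp.bdd_continuous_mul cs (fun x => hM _) (mS f hf))).integrable_sq
    have j2 := (mC'.sub (MemLp.bdd_continuous_mul ca (fun x => hM _) (mC f hf))).integrable_sq
    simp only [Pi.add_apply, Pi.sub_apply] at j1 j2
    rw [← integral_add j1 j2, ← integral_add mk.integrable_sq mθ.integrable_sq]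
    refine integral_congr_ae (Filter.Eventually.of_forall fun x => ?_)
    simp only
    have r1 : Real.cos (θ x) * deriv θ x * f x + Real.sin (θ x) * f' x
        + κ (x - δ) * (Real.sin (θ x) * f x) = Real.cos (θ x) * (deriv θ x * f x)
          + Real.sin (θ x) * (f' x + twoWall κ δ x * f x) := by
      linear_combination f x * eR x
    have r2 : -Real.sin (θ x) * deriv θ x * f x + Real.cos (θ x) * f' x
        - κ (x + δ) * (Real.cos (θ x) * f x) = -Real.sin (θ x) * (deriv θ x * f x)
          + Real.cos (θ x) * (f' x + twoWall κ δ x * f x) := by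
      linear_combination f x * eL x
    rw [r1, r2]
    linear_combination ((deriv θ x * f x) ^ 2 + (f' x + twoWall κ δ x * f x) ^ 2)
      * Real.sin_sq_add_cos_sq (θ x)
  have e3 : ∫ x, (deriv θ x * f x) ^ 2 ≤ a ^ 2 * ∫ x, f x ^ 2 := by
    rw [← integral_const_mul]
    refine integral_mono mθ.integrable_sq (hf.integrable_sq.const_mul _) fun x => ?_
    simp only [mul_pow]
    refine mul_le_mul_of_nonneg_right ?_ (sq_nonneg _)
    rw [← sq_abs]
    exact pow_le_pow_left₀ (abs_nonneg _) (hθ' x) 2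
  nlinarith

end Gap

/-! ### Normalized eigenvector from an unnormalized quasimode -/

section Abstract

variable {X : Type*} [NormedAddCommGroup X] [InnerProductSpace ℝ X]

/-- The quasimode q need not be a unit vector, only close to the unit vector p. Dividing q and s by
‖q‖ changes ⟨q, s⟩ by a product of two quantities of order x, so the eigenvalue error remains
quadratic. -/
lemma exists_unit_eigenvector_near [CompleteSpace X] {B : X →ₗ[ℝ] X}
    (hB : ∀ x y, inner ℝ (B x) y = inner ℝ x (B y)) {p q s : X} (hp : ‖p‖ = 1) (hs : B s = q)
    {C₁ C₂ L x : ℝ} (hL : 0 < L) (hx : 0 ≤ x) (hC₁ : 0 ≤ C₁) (hC₂ : 0 ≤ C₂)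
    (hq : ‖q - p‖ ≤ C₁ * x) (hsx : ‖s‖ ≤ C₂ * x) (h₁ : C₁ * x ≤ 1 / 2)
    (h₂ : 2 * C₂ * x ≤ L / 8) (hgap : ∀ h, inner ℝ q (B h) = 0 → L * ‖B h‖ ≤ ‖h‖) :
    ∃ (E : ℝ) (f : X), f = E • B f ∧ ‖f‖ = 1 ∧ ‖f - p‖ ≤ (16 * C₂ / L + 2 * C₁) * x ∧
      |E - inner ℝ q s| ≤ (16 * C₂ ^ 2 / L + 15 * C₁ * C₂) * x ^ 2 ∧
      (|E| < L → ∀ (E' : ℝ) (g : X), |E'| < L → g = E' • B g →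
        (∃ c : ℝ, g = c • f) ∧ (g ≠ 0 → E' = E)) := by
  set n := ‖q‖ with hn
  have hn1 : |n - 1| ≤ C₁ * x := by
    rw [hn, ← hp]
    exact (abs_norm_sub_norm_le q p).trans hq
  have hn2 : 1 / 2 ≤ n := by linarith [neg_le_of_abs_le hn1]
  have hn3 : n ≤ 3 / 2 := by linarith [le_of_abs_le hn1]
  have hn0 : 0 < n := by linarith
  have hφ : ‖n⁻¹ • q‖ = 1 := by
    rw [norm_smul, ← hn, norm_inv, Real.norm_eq_abs, abs_of_pos hn0]
    exact inv_mul_cancel₀ hn0.ne'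
  have hψ : B (n⁻¹ • s) = n⁻¹ • q := by rw [map_smul, hs]
  have hε : ‖n⁻¹ • s‖ ≤ 2 * C₂ * x := by
    rw [norm_smul, norm_inv, Real.norm_eq_abs, abs_of_pos hn0, inv_mul_le_iff₀ hn0]
    have : 0 ≤ C₂ * x := by positivity
    nlinarith
  have hgap' : ∀ h, inner ℝ (n⁻¹ • q) (B h) = 0 → L * ‖B h‖ ≤ ‖h‖ := by
    intro h h0
    refine hgap h ?_
    rw [inner_smul_left] at h0
    exact (mul_eq_zero.1 h0).resolve_left (by simpa using hn0.ne')
  obtain ⟨E, f, hf, hφf, hfφ, hE⟩ := exists_eigenvector_near hB hφ hψ hL hε h₂ hgap'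
  have hf0 : f ≠ 0 := by rintro rfl; simp at hφf
  have hnf : 0 < ‖f‖ := norm_pos_iff.2 hf0
  refine ⟨E, ‖f‖⁻¹ • f, ?_, ?_, ?_, ?_, ?_⟩
  · rw [map_smul, smul_comm, ← hf]
  · rw [norm_smul, norm_inv, norm_norm]
    exact inv_mul_cancel₀ hnf.ne'
  · have k1 : ‖‖f‖⁻¹ • f - f‖ ≤ ‖f - n⁻¹ • q‖ := by
      have e : ‖f‖⁻¹ • f - f = (‖f‖⁻¹ - 1) • f := by rw [sub_smul, one_smul]
      have e' : ‖(‖f‖⁻¹ - 1) • f‖ = |‖f‖ - 1| := by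
        rw [norm_smul, Real.norm_eq_abs]
        nth_rw 2 [← abs_of_pos hnf]
        rw [← abs_mul, sub_mul, inv_mul_cancel₀ hnf.ne', one_mul, abs_sub_comm]
      rw [e, e', ← hφ]
      exact abs_norm_sub_norm_le _ _
    have k2 : ‖n⁻¹ • q - q‖ ≤ C₁ * x := by
      have e : n⁻¹ • q - q = (n⁻¹ - 1) • q := by rw [sub_smul, one_smul]
      rw [e, norm_smul, Real.norm_eq_abs, ← hn]
      nth_rw 2 [← abs_of_pos hn0]
      rw [← abs_mul, sub_mul, inv_mul_cancel₀ hn0.ne', one_mul, abs_sub_comm]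
      exact hn1
    have k3 : ‖f‖⁻¹ • f - p = (‖f‖⁻¹ • f - f) + (f - n⁻¹ • q) + (n⁻¹ • q - q) + (q - p) := by abel
    rw [k3]
    refine (norm_add_le _ _).trans ?_
    have k4 := norm_add₃_le (a := ‖f‖⁻¹ • f - f) (b := f - n⁻¹ • q) (c := n⁻¹ • q - q)
    have k5 : 4 * (2 * C₂ * x) / L = 8 * C₂ / L * x := by ring
    have k6 : (16 * C₂ / L + 2 * C₁) * x = 2 * (8 * C₂ / L * x) + 2 * (C₁ * x) := by ring
    rw [k5] at hfφ
    rw [k6]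
    linarith
  · have e1 : inner ℝ (n⁻¹ • q) (n⁻¹ • s) = n⁻¹ ^ 2 * inner ℝ q s := by
      rw [inner_smul_left, inner_smul_right]
      simp
      ring
    rw [e1] at hE
    -- With 1/2 ≤ n ≤ 3/2 the constant is 15 = 4 · (3/2) · (5/2), from n⁻² ≤ 4, ‖q‖ ≤ 3/2 and 1 + n
    -- ≤ 5/2.
    have e2 : |n⁻¹ ^ 2 * inner ℝ q s - inner ℝ q s| ≤ 15 * C₁ * C₂ * x ^ 2 := by
      have e3 : n⁻¹ ^ 2 * inner ℝ q s - inner ℝ q s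
          = n⁻¹ ^ 2 * (inner ℝ q s * ((1 - n) * (1 + n))) := by
        field_simp
        ring
      have e4 : |inner ℝ q s| ≤ 3 / 2 * (C₂ * x) :=
        (abs_real_inner_le_norm q s).trans
          (mul_le_mul hn3 hsx (norm_nonneg _) (by norm_num))
      have e5 : |(1 - n) * (1 + n)| ≤ C₁ * x * (5 / 2) := by
        rw [abs_mul, abs_sub_comm, abs_of_pos (by linarith : 0 < 1 + n)]
        exact mul_le_mul hn1 (by linarith) (by linarith) (by positivity)
      have e6 : |n⁻¹ ^ 2| ≤ 4 := by
        rw [abs_of_nonneg (sq_nonneg _)]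
        have : n⁻¹ ≤ 2 := by
          rw [inv_le_comm₀ hn0 (by norm_num)]; linarith
        have h0 : 0 ≤ n⁻¹ := by positivity
        nlinarith
      rw [e3, abs_mul, abs_mul]
      calc |n⁻¹ ^ 2| * (|inner ℝ q s| * |(1 - n) * (1 + n)|)
          ≤ 4 * (3 / 2 * (C₂ * x) * (C₁ * x * (5 / 2))) := by gcongr
        _ = 15 * C₁ * C₂ * x ^ 2 := by ring
    have e7 : E - inner ℝ q s = (E - n⁻¹ ^ 2 * inner ℝ q s)
        + (n⁻¹ ^ 2 * inner ℝ q s - inner ℝ q s) := by ring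
    rw [e7]
    refine (abs_add_le _ _).trans ?_
    have e8 : (16 * C₂ ^ 2 / L + 15 * C₁ * C₂) * x ^ 2
        = 4 * (2 * C₂ * x) ^ 2 / L + 15 * C₁ * C₂ * x ^ 2 := by ring
    rw [e8]
    exact add_le_add hE e2
  · intro hEL E' g hE' hg
    obtain ⟨h1, h2⟩ := eigenvector_unique hB hgap' hf hφf hEL hg hE'
    refine ⟨⟨inner ℝ (n⁻¹ • q) g * ‖f‖, ?_⟩, h2⟩
    rw [mul_smul, smul_smul ‖f‖, mul_inv_cancel₀ hnf.ne', one_smul]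
    exact h1

end Abstract

/-! ### The quasimode and its source -/

/-- A source supported near the right wall; `green` maps it to the truncated zero mode. -/
def quasiSource (κ : ℝ → ℝ) (δ : ℝ) : ℝ → ℝ :=
  (Set.Icc (δ - 2) (δ - 1)).indicator fun y =>
    profile κ δ * Real.exp (primitive (twoWall κ δ) y)

/-- The zero mode of the right wall, truncated near the left wall. -/
def quasimode (κ : ℝ → ℝ) (δ : ℝ) : ℝ → ℝ := green (twoWall κ δ) (quasiSource κ δ)

namespace IsDomainWall

variable {κ : ℝ → ℝ} {κinf δ : ℝ}

lemma memLp_quasiSource (hκ : IsDomainWall κ κinf) (δ : ℝ) : MemLp (quasiSource κ δ) 2 volume := by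
  have hc : Continuous fun y => profile κ δ * Real.exp (primitive (twoWall κ δ) y) :=
    continuous_const.mul (continuous_primitive (hκ.continuous_twoWall δ)).rexp
  rw [quasiSource, memLp_indicator_iff_restrict measurableSet_Icc,
    memLp_two_iff_integrable_sq hc.aestronglyMeasurable]
  exact (hc.pow 2).integrableOn_Icc

lemma memLp_quasimode (hκ : IsDomainWall κ κinf) (δ : ℝ) : MemLp (quasimode κ δ) 2 volume :=
  (hκ.isConfining_twoWall δ).memLp_green (hκ.memLp_quasiSource δ)

/-- The exponential in the source cancels the one in the kernel, leaving a constant integrated over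
part of an interval of length one. This last factor is a piecewise linear cutoff: 0 for x ≤ 1 - δ
and 1 for x ≥ 2 - δ. -/
lemma quasimode_eq (x : ℝ) : quasimode κ δ x
    = profile κ δ * Real.exp (-primitive (twoWall κ δ) x)
      * volume.real (Set.Icc (δ - 2) (δ - 1) ∩ Set.Ioi (-x)) := by
  have e : ∀ y, Real.exp (-primitive (twoWall κ δ) y) * quasiSource κ δ y
      = (Set.Icc (δ - 2) (δ - 1)).indicator (fun _ => profile κ δ) y := by
    intro y
    by_cases hy : y ∈ Set.Icc (δ - 2) (δ - 1)
    · rw [quasiSource, Set.indicator_of_mem hy, Set.indicator_of_mem hy, mul_left_comm,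
        ← Real.exp_add, neg_add_cancel, Real.exp_zero, mul_one]
    · rw [quasiSource, Set.indicator_of_notMem hy, Set.indicator_of_notMem hy, mul_zero]
  rw [quasimode, green_eq, integral_congr_ae (Filter.Eventually.of_forall e),
    integral_indicator measurableSet_Icc, setIntegral_const,
    measureReal_restrict_apply measurableSet_Icc, smul_eq_mul]
  ring

/-- To the right of the transition region of the left wall the two wall mass is just κ(· - δ), so
there exp(-P) is a multiple of the shifted zero mode. -/
lemma primitive_twoWall (hκ : IsDomainWall κ κinf) (hδ : 2 ≤ δ) {x : ℝ} (hx : -δ + 1 ≤ x) :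
    primitive (twoWall κ δ) x = primitive κ (x - δ) - primitive κ δ := by
  have h : primitive (twoWall κ δ) x = ∫ y in (0 : ℝ)..x, κ (y - δ) := by
    refine intervalIntegral.integral_congr fun y hy => ?_
    have hy1 : -δ + 1 ≤ y := (le_min (by linarith) hx).trans hy.1
    rcases le_total 0 y with h0 | h0
    · exact hκ.twoWall_of_nonneg h0
    · rw [twoWall_of_nonpos h0, hκ.eq_of_one_le _ (by linarith), hκ.eq_of_le_neg_one _ (by linarith)]
  rw [h, intervalIntegral.integral_comp_sub_right (fun y => κ y), zero_sub,
    ← primitive_sub hκ.continuous, primitive_neg_of_odd hκ.odd]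

lemma profile_mul_exp (hκ : IsDomainWall κ κinf) (hδ : 2 ≤ δ) {x : ℝ} (hx : -δ + 1 ≤ x) :
    profile κ δ * Real.exp (-primitive (twoWall κ δ) x) = profile κ (x - δ) := by
  rw [hκ.primitive_twoWall hδ hx, profile, profile, mul_assoc, ← Real.exp_add]
  congr 2
  ring

lemma quasimode_of_lt (hκ : IsDomainWall κ κinf) (hδ : 2 ≤ δ) {x : ℝ} (hx : -δ + 2 < x) :
    quasimode κ δ x = profile κ (x - δ) := by
  have h : Set.Icc (δ - 2) (δ - 1) ∩ Set.Ioi (-x) = Set.Icc (δ - 2) (δ - 1) := by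
    refine Set.inter_eq_left.2 fun y hy => ?_
    rw [Set.mem_Ioi]
    linarith [hy.1]
  rw [quasimode_eq, h, hκ.profile_mul_exp hδ (by linarith), Real.volume_real_Icc]
  norm_num

lemma quasimode_nonneg (hκ : IsDomainWall κ κinf) (x : ℝ) : 0 ≤ quasimode κ δ x := by
  have := hκ.profile_pos δ
  rw [quasimode_eq]
  positivity

lemma quasimode_le (hκ : IsDomainWall κ κinf) (hδ : 2 ≤ δ) (x : ℝ) :
    quasimode κ δ x ≤ profile κ (x - δ) := by
  rcases le_total (-δ + 1) x with hx | hx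
  · rw [quasimode_eq, hκ.profile_mul_exp hδ hx]
    refine mul_le_of_le_one_right (hκ.profile_pos _).le ?_
    calc volume.real (Set.Icc (δ - 2) (δ - 1) ∩ Set.Ioi (-x))
        ≤ volume.real (Set.Icc (δ - 2) (δ - 1)) :=
          measureReal_mono Set.inter_subset_left (by simp)
      _ = 1 := by rw [Real.volume_real_Icc]; norm_num
  · have h : Set.Icc (δ - 2) (δ - 1) ∩ Set.Ioi (-x) = ∅ := by
      refine Set.eq_empty_of_forall_notMem fun y hy => ?_
      have h1 := hy.1.2
      have h2 := hy.2.out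
      linarith
    rw [quasimode_eq, h, measureReal_empty, mul_zero]
    exact (hκ.profile_pos _).le

/-- For δ > 2 the support of the source lies where the cutoff is 1, and the exponentials cancel once
more; the unit length of the interval makes the leading term of the eigenvalue exact. -/
lemma integral_quasimode_mul_quasiSource (hκ : IsDomainWall κ κinf) (hδ : 2 < δ) :
    ∫ x, quasimode κ δ x * quasiSource κ δ x = profile κ δ ^ 2 := by
  have e : ∀ x, quasimode κ δ x * quasiSource κ δ x
      = (Set.Icc (δ - 2) (δ - 1)).indicator (fun _ => profile κ δ ^ 2) x := by
    intro x
    by_cases hx : x ∈ Set.Icc (δ - 2) (δ - 1)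
    · have h1 := hx.1
      rw [quasiSource, Set.indicator_of_mem hx, Set.indicator_of_mem hx,
        hκ.quasimode_of_lt hδ.le (by linarith), ← hκ.profile_mul_exp hδ.le (by linarith)]
      have : Real.exp (-primitive (twoWall κ δ) x) * Real.exp (primitive (twoWall κ δ) x) = 1 := by
        rw [← Real.exp_add, neg_add_cancel, Real.exp_zero]
      linear_combination profile κ δ ^ 2 * this
    · rw [quasiSource, Set.indicator_of_notMem hx, Set.indicator_of_notMem hx, mul_zero]
  rw [integral_congr_ae (Filter.Eventually.of_forall e), integral_indicator measurableSet_Icc,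
    setIntegral_const, Real.volume_real_Icc, smul_eq_mul]
  norm_num

lemma profile_sq : profile κ δ ^ 2
    = 2 * gammaConst κ ^ 2 * Real.exp (-(2 * ∫ y in (0 : ℝ)..δ, κ y)) := by
  rw [profile, primitive, mul_pow, mul_pow, Real.sq_sqrt (by norm_num), ← Real.exp_nat_mul]
  congr 2
  push_cast
  ring

/-- Two factors exp(-P(δ)), P being the primitive of κ, appear: one from the profile at δ and one
from the primitive of the two wall mass near the right wall. Each is O(exp(-κinf δ)). -/
lemma exists_integral_quasiSource_sq_le (hκ : IsDomainWall κ κinf) :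
    ∃ C, 0 < C ∧ ∀ δ, 2 ≤ δ →
      ∫ x, quasiSource κ δ x ^ 2 ≤ (C * Real.exp (-(2 * κinf * δ))) ^ 2 := by
  obtain ⟨M, hM⟩ := hκ.exists_abs_le
  have hM0 : 0 ≤ M := (abs_nonneg _).trans (hM 0)
  obtain ⟨c, hc0, hc⟩ := hκ.exists_le_primitive
  have hγ := hκ.gammaConst_pos
  refine ⟨√2 * gammaConst κ * Real.exp (2 * c + 2 * M), by positivity, fun δ hδ => ?_⟩
  set b := √2 * gammaConst κ * Real.exp (2 * c + 2 * M) * Real.exp (-(2 * κinf * δ)) with hb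
  have hle : ∀ y ∈ Set.Icc (δ - 2) (δ - 1),
      (profile κ δ * Real.exp (primitive (twoWall κ δ) y)) ^ 2 ≤ b ^ 2 := by
    intro y hy
    have hp := hκ.profile_pos δ
    refine pow_le_pow_left₀ (by positivity) ?_ 2
    have h1 := hc δ
    rw [abs_of_nonneg (by linarith)] at h1
    have h2 := le_of_abs_le (abs_primitive_le hM (y - δ))
    have h3 : |y - δ| ≤ 2 := by rw [abs_le]; exact ⟨by linarith [hy.1], by linarith [hy.2]⟩
    have h4 := mul_le_mul_of_nonneg_left h3 hM0
    rw [hκ.primitive_twoWall hδ (by linarith [hy.1]), profile, hb, mul_assoc, mul_assoc _ (Real.exp _),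
      ← Real.exp_add, ← Real.exp_add]
    refine mul_le_mul_of_nonneg_left (Real.exp_le_exp.2 ?_) (by positivity)
    linarith
  have e : ∀ x, quasiSource κ δ x ^ 2
      = (Set.Icc (δ - 2) (δ - 1)).indicator
        (fun y => (profile κ δ * Real.exp (primitive (twoWall κ δ) y)) ^ 2) x := by
    intro x
    by_cases hx : x ∈ Set.Icc (δ - 2) (δ - 1)
    · rw [quasiSource, Set.indicator_of_mem hx, Set.indicator_of_mem hx]
    · rw [quasiSource, Set.indicator_of_notMem hx, Set.indicator_of_notMem hx, sq, mul_zero]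
  rw [integral_congr_ae (Filter.Eventually.of_forall e), integral_indicator measurableSet_Icc]
  have hcont : Continuous fun y => (profile κ δ * Real.exp (primitive (twoWall κ δ) y)) ^ 2 :=
    (continuous_const.mul (continuous_primitive (hκ.continuous_twoWall δ)).rexp).pow 2
  refine (setIntegral_mono_on hcont.integrableOn_Icc (continuous_const.integrableOn_Icc)
    measurableSet_Icc hle).trans ?_
  rw [setIntegral_const, Real.volume_real_Icc, smul_eq_mul]
  norm_num

/-- Functions squeezed with the shifted zero mode differ little from it in `L²`. -/
lemma integral_sq_le_of_abs_le (hκ : IsDomainWall κ κinf) {r : ℝ → ℝ} {s : ℝ}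
    (h0 : ∀ x, s < x → r x = 0) (h1 : ∀ x, |r x| ≤ profile κ (x - δ)) (hr : MemLp r 2 volume) :
    ∫ x, r x ^ 2 ≤ ∫ x in Set.Iic (s - δ), profile κ x ^ 2 := by
  have hp : Integrable fun x => (Set.Iic s).indicator (fun x => profile κ (x - δ) ^ 2) x := by
    rw [integrable_indicator_iff measurableSet_Iic]
    have := (memLp_comp_add hκ.memLp_profile (-δ)).integrable_sq
    simp only [← sub_eq_add_neg] at this
    exact this.integrableOn
  have hle : ∀ x, r x ^ 2 ≤ (Set.Iic s).indicator (fun x => profile κ (x - δ) ^ 2) x := by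
    intro x
    by_cases hx : x ∈ Set.Iic s
    · rw [Set.indicator_of_mem hx, ← sq_abs]
      exact pow_le_pow_left₀ (abs_nonneg _) (h1 x) 2
    · rw [Set.indicator_of_notMem hx, h0 x (not_le.1 hx)]
      norm_num
  refine (integral_mono hr.integrable_sq hp hle).trans (le_of_eq ?_)
  rw [← integral_add_right_eq_self _ δ, ← integral_indicator measurableSet_Iic]
  refine integral_congr_ae (Filter.Eventually.of_forall fun x => ?_)
  by_cases hx : x ≤ s - δ
  · have hx' : x + δ ∈ Set.Iic s := by rw [Set.mem_Iic]; linarith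
    simp only [Set.indicator_of_mem hx', Set.indicator_of_mem (show x ∈ Set.Iic (s - δ) from hx),
      add_sub_cancel_right]
  · have hx' : x + δ ∉ Set.Iic s := by rw [Set.mem_Iic]; intro h; exact hx (by linarith)
    simp only [Set.indicator_of_notMem hx',
      Set.indicator_of_notMem (show x ∉ Set.Iic (s - δ) from hx)]

end IsDomainWall

/-! ### Gap and eigenvector of the scalar operator -/

section Scalar

variable {κ : ℝ → ℝ} {κinf : ℝ}

/-- In the localization estimate the remaining overlap is with sin θ times the zero mode.
Orthogonality to the quasimode replaces it by the difference of the two, which vanishes beyond δ/2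
and so has squared norm O(exp(-κinf δ)). -/
lemma SpectralGap.exists_green_gap (hgap : SpectralGap κ κinf) (hκ : IsDomainWall κ κinf) :
    ∃ A C : ℝ, ∀ δ, 2 ≤ δ → ∀ h : ℝ → ℝ, MemLp h 2 volume →
      ∫ x, quasimode κ δ x * green (twoWall κ δ) h x = 0 →
      (κinf ^ 2 - (A / δ) ^ 2 - κinf ^ 2 * (C * Real.exp (-(κinf * δ))))
        * ∫ x, green (twoWall κ δ) h x ^ 2 ≤ ∫ x, h x ^ 2 := by
  obtain ⟨M, hM⟩ := hκ.exists_abs_le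
  obtain ⟨A, hA⟩ := exists_angle
  obtain ⟨C, hC0, hC⟩ := hκ.exists_integral_Iic_profile_sq_le
  refine ⟨A, C, fun δ hδ h hh h0 => ?_⟩
  obtain ⟨θ, hθ, hθ0, hθ1, hθ2, hθ3, hθ'⟩ := hA δ (by linarith)
  have hm := hκ.isConfining_twoWall δ
  have hf := hm.memLp_green hh
  have hr := memLp_comp_neg hh
  have hf' : MemLp (fun x => h (-x) - twoWall κ δ x * green (twoWall κ δ) h x) 2 volume :=
    hr.sub (MemLp.bdd_continuous_mul hm.continuous (IsDomainWall.abs_twoWall_le hM δ) hf)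
  have hloc := hgap.localization hκ hδ hθ hθ0 hθ1 hθ' hf hf' (hm.isWeakDeriv_green hh)
  simp only [sub_add_cancel] at hloc
  rw [integral_neg_eq_self (fun x => h x ^ 2)] at hloc
  have hp : MemLp (fun x => profile κ (x - δ)) 2 volume := by
    simpa only [sub_eq_add_neg] using memLp_comp_add hκ.memLp_profile (-δ)
  have hps : MemLp (fun x => Real.sin (θ x) * profile κ (x - δ)) 2 volume :=
    MemLp.bdd_continuous_mul hθ.sin.continuous (fun x => Real.abs_sin_le_one _) hp
  have hq := hκ.memLp_quasimode δ
  have hs0 : ∀ x, 0 ≤ Real.sin (θ x) := fun x =>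
    Real.sin_nonneg_of_nonneg_of_le_pi (hθ2 x) (by linarith [hθ3 x, Real.pi_pos])
  have hrr : MemLp (fun x => Real.sin (θ x) * profile κ (x - δ) - quasimode κ δ x) 2 volume :=
    hps.sub hq
  have hsq := hκ.integral_sq_le_of_abs_le (δ := δ) (s := δ / 2) (r := fun x =>
    Real.sin (θ x) * profile κ (x - δ) - quasimode κ δ x) (fun x hx => by
      rw [hθ1 x hx.le, Real.sin_pi_div_two, one_mul, hκ.quasimode_of_lt hδ (by linarith), sub_self])
    (fun x => by
      have h1 := hκ.quasimode_nonneg (δ := δ) x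
      have h2 := hκ.quasimode_le hδ x
      have h3 := hκ.profile_pos (x - δ)
      have h4 := mul_le_of_le_one_left h3.le (Real.sin_le_one (θ x))
      have h5 := mul_nonneg (hs0 x) h3.le
      rw [abs_le]
      constructor <;> linarith) hrr
  have hsq' := hsq.trans (hC (δ / 2 - δ))
  have e1 : 2 * κinf * (δ / 2 - δ) = -(κinf * δ) := by ring
  rw [e1] at hsq'
  have e2 : ∫ x, profile κ (x - δ) * (Real.sin (θ x) * green (twoWall κ δ) h x)
      = ∫ x, (Real.sin (θ x) * profile κ (x - δ) - quasimode κ δ x) * green (twoWall κ δ) h x := by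
    have e3 : (fun x => (Real.sin (θ x) * profile κ (x - δ) - quasimode κ δ x)
        * green (twoWall κ δ) h x) = fun x => Real.sin (θ x) * profile κ (x - δ)
          * green (twoWall κ δ) h x - quasimode κ δ x * green (twoWall κ δ) h x := by
      funext x; ring
    have i1 : Integrable fun x => Real.sin (θ x) * profile κ (x - δ) * green (twoWall κ δ) h x :=
      hps.integrable_mul hf
    have i2 : Integrable fun x => quasimode κ δ x * green (twoWall κ δ) h x := hq.integrable_mul hf
    rw [e3, integral_sub i1 i2, h0, sub_zero]
    refine integral_congr_ae (Filter.Eventually.of_forall fun x => ?_)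
    simp only
    ring
  have hcs := sq_integral_mul_le hrr hf
  rw [← e2] at hcs
  have hn : 0 ≤ ∫ x, green (twoWall κ δ) h x ^ 2 := integral_nonneg fun x => sq_nonneg _
  have hcs' := hcs.trans (mul_le_mul_of_nonneg_right hsq' hn)
  have := mul_le_mul_of_nonneg_left hcs' (sq_nonneg κinf)
  nlinarith

lemma SpectralGap.eventually_greenOp_gap (hgap : SpectralGap κ κinf) (hκ : IsDomainWall κ κinf)
    {L : ℝ} (hL0 : 0 < L) (hL : L < κinf) :
    ∀ᶠ δ in Filter.atTop, ∀ h : RealL2,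
      inner ℝ ((hκ.memLp_quasimode δ).toLp _ : RealL2) ((hκ.isConfining_twoWall δ).greenOp h) = 0 →
      L * ‖(hκ.isConfining_twoWall δ).greenOp h‖ ≤ ‖h‖ := by
  obtain ⟨A, C, hAC⟩ := hgap.exists_green_gap hκ
  have hlim : Filter.Tendsto (fun δ : ℝ => κinf ^ 2 - (A / δ) ^ 2
      - κinf ^ 2 * (C * Real.exp (-(κinf * δ)))) Filter.atTop
      (nhds (κinf ^ 2 - 0 ^ 2 - κinf ^ 2 * (C * 0))) := by
    refine (tendsto_const_nhds.sub ((Filter.tendsto_id.const_div_atTop A).pow 2)).sub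
      ((Filter.Tendsto.const_mul C ?_).const_mul _)
    exact Real.tendsto_exp_neg_atTop_nhds_zero.comp
      (Filter.tendsto_id.const_mul_atTop hκ.pos)
  have hLsq : L ^ 2 < κinf ^ 2 - 0 ^ 2 - κinf ^ 2 * (C * 0) := by nlinarith
  filter_upwards [hlim.eventually_const_lt hLsq, Filter.eventually_ge_atTop 2] with δ h1 h2 h h0
  rw [IsConfining.greenOp_apply, inner_toLp] at h0
  have h3 := hAC δ h2 h (Lp.memLp h) h0
  rw [← norm_sq_toLp ((hκ.isConfining_twoWall δ).memLp_green (Lp.memLp h)),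
    ← IsConfining.greenOp_apply (hκ.isConfining_twoWall δ), ← norm_sq_toLp (Lp.memLp h), Lp.toLp_coeFn] at h3
  have h4 := mul_le_mul_of_nonneg_right h1.le
    (sq_nonneg ‖(hκ.isConfining_twoWall δ).greenOp h‖)
  refine le_of_sq_le_sq ?_ (norm_nonneg _)
  rw [mul_pow]
  exact h4.trans h3

lemma IsDomainWall.memLp_profile_shift (hκ : IsDomainWall κ κinf) (δ : ℝ) :
    MemLp (fun x => profile κ (x - δ)) 2 volume := by
  simpa only [sub_eq_add_neg] using memLp_comp_add hκ.memLp_profile (-δ)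

lemma IsDomainWall.exists_norm_quasimode_sub_le (hκ : IsDomainWall κ κinf) :
    ∃ C, 0 < C ∧ ∀ δ, 2 ≤ δ → ‖((hκ.memLp_quasimode δ).toLp _ : RealL2)
      - (hκ.memLp_profile_shift δ).toLp _‖ ≤ C * Real.exp (-(2 * κinf * δ)) := by
  obtain ⟨C, hC0, hC⟩ := hκ.exists_integral_Iic_profile_sq_le
  refine ⟨√C * Real.exp (2 * κinf), by positivity, fun δ hδ => ?_⟩
  have hq := hκ.memLp_quasimode δ
  have hp := hκ.memLp_profile_shift δ
  rw [← MemLp.toLp_sub]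
  -- The quasimode and the zero mode differ only for x ≤ 2 - δ, at distance 2δ - 2 from the right
  -- wall.
  have h := (hκ.integral_sq_le_of_abs_le (δ := δ) (s := -δ + 2)
    (r := quasimode κ δ - fun x => profile κ (x - δ)) (fun x hx => by
      rw [Pi.sub_apply, hκ.quasimode_of_lt hδ hx, sub_self])
    (fun x => by
      have h1 := hκ.quasimode_nonneg (δ := δ) x
      have h2 := hκ.quasimode_le hδ x
      rw [Pi.sub_apply, abs_le]
      constructor <;> linarith) (hq.sub hp)).trans (hC (-δ + 2 - δ))
  rw [← norm_sq_toLp (hq.sub hp)] at h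
  refine le_of_sq_le_sq (h.trans (le_of_eq ?_)) (by positivity)
  rw [mul_pow, mul_pow, Real.sq_sqrt hC0.le, ← Real.exp_nat_mul, ← Real.exp_nat_mul,
    mul_assoc C, ← Real.exp_add]
  congr 2
  push_cast
  ring

/-- The scalar form of the theorem: spectral picture of the operator `f ↦ (f' + κ^δ f) ∘ (- ·)`
through its inverse. -/
theorem SpectralGap.exists_scalar_eigenvector (hgap : SpectralGap κ κinf)
    (hκ : IsDomainWall κ κinf) {K : ℝ} (hK0 : 0 < K) (hK : K < κinf) :
    ∃ C, 0 < C ∧ ∀ᶠ δ in Filter.atTop, ∃ (E : ℝ) (f : RealL2),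
      f = E • (hκ.isConfining_twoWall δ).greenOp f ∧ ‖f‖ = 1 ∧
      ‖f - (hκ.memLp_profile_shift δ).toLp _‖ ≤ C * Real.exp (-(2 * κinf * δ)) ∧
      |E - 2 * gammaConst κ ^ 2 * Real.exp (-(2 * ∫ y in (0 : ℝ)..δ, κ y))|
        ≤ C * Real.exp (-(4 * κinf * δ)) ∧ |E| ≤ K ∧
      ∀ (E' : ℝ) (g : RealL2), |E'| ≤ K → g = E' • (hκ.isConfining_twoWall δ).greenOp g →
        (∃ c : ℝ, g = c • f) ∧ (g ≠ 0 → E' = E) := by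
  obtain ⟨C₁, hC₁, hq⟩ := hκ.exists_norm_quasimode_sub_le
  obtain ⟨C₂, hC₂, hs⟩ := hκ.exists_integral_quasiSource_sq_le
  -- The gap of the two wall problem reaches any L < κinf for large δ; strictness on both sides lets
  -- uniqueness below L cover all of [-K, K].
  obtain ⟨L, hKL, hLκ⟩ := exists_between hK
  have hL : 0 < L := hK0.trans hKL
  set D := 16 * C₂ ^ 2 / L + 15 * C₁ * C₂ with hD
  have hD0 : 0 < D := by positivity
  refine ⟨(16 * C₂ / L + 2 * C₁) + D, by positivity, ?_⟩
  have hlim : Filter.Tendsto (fun δ : ℝ => Real.exp (-(2 * κinf * δ))) Filter.atTop (nhds 0) :=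
    Real.tendsto_exp_neg_atTop_nhds_zero.comp
      (Filter.tendsto_id.const_mul_atTop (by linarith [hκ.pos] : 0 < 2 * κinf))
  have hev : ∀ (c b : ℝ), 0 < b → ∀ᶠ δ : ℝ in Filter.atTop,
      c * Real.exp (-(2 * κinf * δ)) < b := by
    intro c b hb
    have := hlim.const_mul c
    rw [mul_zero] at this
    exact this.eventually_lt_const hb
  -- The conditions are the gap, the two smallness hypotheses of the abstract lemma, x < 1, and |E|
  -- ≤ K through |E| ≤ (3/2) C₂ x + D x².
  filter_upwards [hgap.eventually_greenOp_gap hκ hL hLκ, hev C₁ (1 / 2) (by norm_num),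
    hev (2 * C₂) (L / 8) (by linarith), hev 1 1 one_pos, hev (D + 3 / 2 * C₂) K hK0,
    Filter.eventually_gt_atTop 2] with δ g1 g2 g3 g4 g5 g6
  set x := Real.exp (-(2 * κinf * δ)) with hx
  have hx0 : 0 < x := Real.exp_pos _
  have hx2 : x ^ 2 = Real.exp (-(4 * κinf * δ)) := by
    rw [hx, ← Real.exp_nat_mul]
    congr 1
    push_cast
    ring
  have hp : ‖((hκ.memLp_profile_shift δ).toLp _ : RealL2)‖ = 1 := by
    have h := norm_sq_toLp (hκ.memLp_profile_shift δ)
    rw [integral_sub_right_eq_self (fun x => profile κ x ^ 2), hκ.integral_profile_sq] at h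
    exact (pow_eq_one_iff_of_nonneg (norm_nonneg _) two_ne_zero).1 h
  have hsn : ‖((hκ.memLp_quasiSource δ).toLp _ : RealL2)‖ ≤ C₂ * x := by
    refine le_of_sq_le_sq ?_ (by positivity)
    rw [norm_sq_toLp]
    exact hs δ g6.le
  obtain ⟨E, f, hf, hf1, hfp, hE, huniq⟩ := exists_unit_eigenvector_near
    (hκ.isConfining_twoWall δ).greenOp_symm hp
    ((hκ.isConfining_twoWall δ).greenOp_toLp (hκ.memLp_quasiSource δ)) hL hx0.le hC₁.le hC₂.le
    (hq δ g6.le) hsn g2.le g3.le g1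
  have hin : inner ℝ (((hκ.isConfining_twoWall δ).memLp_green (hκ.memLp_quasiSource δ)).toLp _ :
      RealL2) ((hκ.memLp_quasiSource δ).toLp _)
      = 2 * gammaConst κ ^ 2 * Real.exp (-(2 * ∫ y in (0 : ℝ)..δ, κ y)) := by
    rw [inner_toLp, ← IsDomainWall.profile_sq]
    exact hκ.integral_quasimode_mul_quasiSource g6
  have hin2 : |inner ℝ (((hκ.isConfining_twoWall δ).memLp_green (hκ.memLp_quasiSource δ)).toLp _ :
      RealL2) ((hκ.memLp_quasiSource δ).toLp (quasiSource κ δ))| ≤ 3 / 2 * (C₂ * x) := by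
    refine (abs_real_inner_le_norm _ _).trans (mul_le_mul ?_ hsn (norm_nonneg _) (by norm_num))
    have := norm_le_norm_add_norm_sub' ((hκ.memLp_quasimode δ).toLp _ : RealL2)
      ((hκ.memLp_profile_shift δ).toLp _)
    rw [hp] at this
    exact this.trans (by linarith [hq δ g6.le])
  have hEK : |E| ≤ K := by
    have h1 := abs_sub_abs_le_abs_sub E (inner ℝ
      (((hκ.isConfining_twoWall δ).memLp_green (hκ.memLp_quasiSource δ)).toLp _ : RealL2)
      ((hκ.memLp_quasiSource δ).toLp (quasiSource κ δ)))
    have h2 : x ^ 2 ≤ x := by nlinarith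
    have h3 := mul_le_mul_of_nonneg_left h2 hD0.le
    linarith
  refine ⟨E, f, hf, hf1, hfp.trans ?_, ?_, hEK, fun E' g hE' hg =>
    huniq (hEK.trans_lt hKL) E' g (hE'.trans_lt hKL) hg⟩
  · exact mul_le_mul_of_nonneg_right (by linarith) hx0.le
  · rw [← hin, ← hx2]
    refine hE.trans (mul_le_mul_of_nonneg_right ?_ (sq_nonneg _))
    have : 0 ≤ 16 * C₂ / L + 2 * C₁ := by positivity
    linarith

end Scalar

/-! ### Passage between scalar and spinor eigenfunctions -/

/-- The complex component of a spinor along `spinorR`. -/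
def coordR : Spinor →ₗ[ℝ] ℂ where
  toFun z := (z 0 - Complex.I * z 1) / 2
  map_add' z w := by simp only [PiLp.add_apply]; ring
  map_smul' c z := by
    simp only [PiLp.smul_apply, Complex.real_smul, RingHom.id_apply]; ring

/-- The complex component of a spinor along `I • spinorL`. -/
def coordL : Spinor →ₗ[ℝ] ℂ where
  toFun z := (z 1 - Complex.I * z 0) / 2
  map_add' z w := by simp only [PiLp.add_apply]; ring
  map_smul' c z := by
    simp only [PiLp.smul_apply, Complex.real_smul, RingHom.id_apply]; ring

lemma coord_expansion (z : Spinor) :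
    z = coordR z • spinorR + coordL z • (Complex.I • spinorL) := by
  ext i
  fin_cases i
  · simp [coordR, coordL, spinorR, spinorL]
    linear_combination (z 0 / 2) * Complex.I_sq
  · simp [coordR, coordL, spinorR, spinorL]
    linear_combination (z 1 / 2) * Complex.I_sq

lemma coordR_diracExpr (κ : ℝ → ℝ) (F G : H) (x : ℝ) :
    coordR (diracExpr κ F G x) = -(coordL (G x) - κ x * coordL (F x)) := by
  simp [coordR, coordL, diracExpr, σ₁, σ₃, Matrix.toLpLin_apply, Matrix.vecHead, Matrix.vecTail]
  linear_combination (G x 1 / 2) * Complex.I_sq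

lemma coordL_diracExpr (κ : ℝ → ℝ) (F G : H) (x : ℝ) :
    coordL (diracExpr κ F G x) = coordR (G x) + κ x * coordR (F x) := by
  simp [coordR, coordL, diracExpr, σ₁, σ₃, Matrix.toLpLin_apply, Matrix.vecHead, Matrix.vecTail]
  linear_combination (-G x 0 / 2) * Complex.I_sq

lemma diracExpr_eq (κ : ℝ → ℝ) (F G : H) (x a b a' b' : ℝ)
    (hF : F x = a • spinorR + b • (Complex.I • spinorL))
    (hG : G x = a' • spinorR + b' • (Complex.I • spinorL)) :
    diracExpr κ F G x
      = (-(b' - κ x * b)) • spinorR + (a' + κ x * a) • (Complex.I • spinorL) := by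
  rw [diracExpr, hF, hG]
  ext i
  fin_cases i <;>
    simp [spinorR, spinorL, σ₁, σ₃, Matrix.toLpLin_apply] <;> ring_nf <;> simp <;> ring

lemma norm_sq_combination (a b : ℝ) :
    ‖a • spinorR + b • (Complex.I • spinorL)‖ ^ 2 = 2 * a ^ 2 + 2 * b ^ 2 := by
  have e : a • spinorR + b • (Complex.I • spinorL)
      = (a : ℂ) • spinorR + ((b : ℂ) * Complex.I) • spinorL := by
    rw [mul_smul, Complex.coe_smul, Complex.coe_smul]
  rw [e, norm_add_sq (𝕜 := ℂ), inner_smul_left, inner_smul_right, inner_spinorR_spinorL, norm_smul,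
    norm_smul, mul_pow, mul_pow, norm_sq_spinorR, norm_sq_spinorL]
  simp
  ring

/-- The spinor field `½ (f(x) (1, i) + s i f(-x) (1, -i))`. -/
def assemble (s : ℝ) (f : RealL2) : H :=
  spinorField (Lp.memLp f) ((1 / 2 : ℝ) • spinorR)
    + spinorField (memLp_comp_neg (Lp.memLp f)) ((s / 2) • (Complex.I • spinorL))

lemma coeFn_spinorField_add {f g : ℝ → ℝ} (hf : MemLp f 2 volume) (hg : MemLp g 2 volume)
    (s : ℝ) : ∀ᵐ x, (spinorField hf ((1 / 2 : ℝ) • spinorR)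
      + spinorField hg ((s / 2) • (Complex.I • spinorL)) : H) x
      = (f x / 2) • spinorR + (s * g x / 2) • (Complex.I • spinorL) := by
  filter_upwards [Lp.coeFn_add (spinorField hf ((1 / 2 : ℝ) • spinorR))
    (spinorField hg ((s / 2) • (Complex.I • spinorL))), coeFn_spinorField hf ((1 / 2 : ℝ) • spinorR),
    coeFn_spinorField hg ((s / 2) • (Complex.I • spinorL))] with x h1 h2 h3
  rw [h1, Pi.add_apply, h2, h3, smul_smul, smul_smul]
  congr 2 <;> ring

lemma coeFn_assemble (s : ℝ) (f : RealL2) : ∀ᵐ x, assemble s f x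
    = (f x / 2) • spinorR + (s * f (-x) / 2) • (Complex.I • spinorL) :=
  coeFn_spinorField_add _ _ s

lemma ae_comp_neg {p : ℝ → Prop} (h : ∀ᵐ x, p x) : ∀ᵐ x, p (-x) :=
  (Measure.measurePreserving_neg (volume : Measure ℝ)).quasiMeasurePreserving.ae h

lemma assemble_sub (s : ℝ) (f g : RealL2) : assemble s (f - g) = assemble s f - assemble s g := by
  refine Lp.ext ?_
  filter_upwards [coeFn_assemble s (f - g), coeFn_assemble s f, coeFn_assemble s g,
    Lp.coeFn_sub (assemble s f) (assemble s g), Lp.coeFn_sub f g,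
    ae_comp_neg (Lp.coeFn_sub f g)] with x h1 h2 h3 h4 h5 h6
  rw [h1, h4, Pi.sub_apply, h2, h3, h5, h6, Pi.sub_apply, Pi.sub_apply]
  module

/-- The two spinor directions are orthogonal of squared norm 2, and reflection preserves the L²
norm, so each component contributes half of ‖f‖². -/
lemma norm_assemble {s : ℝ} (hs : s ^ 2 = 1) (f : RealL2) : ‖assemble s f‖ = ‖f‖ := by
  have hf := Lp.memLp f
  have h : ‖assemble s f‖ ^ 2 = ‖f‖ ^ 2 := by
    have e : ∀ᵐ x, ‖assemble s f x‖ ^ 2 = 1 / 2 * f x ^ 2 + 1 / 2 * f (-x) ^ 2 := by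
      filter_upwards [coeFn_assemble s f] with x hx
      rw [hx, norm_sq_combination]
      linear_combination (1 / 2 * f (-x) ^ 2) * hs
    rw [norm_sq_eq_integral, integral_congr_ae e, integral_add (hf.integrable_sq.const_mul _)
      ((memLp_comp_neg hf).integrable_sq.const_mul _), integral_const_mul, integral_const_mul,
      integral_neg_eq_self (fun x => f x ^ 2), ← norm_sq_toLp hf, Lp.toLp_coeFn]
    ring
  exact (sq_eq_sq₀ (norm_nonneg _) (norm_nonneg _)).1 h

section Transfer

variable {m : ℝ → ℝ} {M : ℝ}

/-- The component along (1, i) uses the scalar equation at x, the other one the same equation at -x;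
evenness of m and s² = 1 make the two consistent. -/
lemma assemble_mem_eigenspace (hm : IsConfining m) (hM : ∀ x, |m x| ≤ M) {E s : ℝ}
    (hs : s ^ 2 = 1) {f : RealL2} (hf : f = E • hm.greenOp f) :
    assemble s f ∈ eigenspace (dirac m) ((s * E : ℝ) : ℂ) := by
  have mf := Lp.memLp f
  have mg : MemLp (fun x => E * f x) 2 volume := mf.const_mul E
  have hfe : f = hm.greenOp (mg.toLp _) := by
    have e : mg.toLp _ = E • f := by
      refine Lp.ext ?_
      filter_upwards [mg.coeFn_toLp, Lp.coeFn_smul E f] with x h1 h2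
      rw [h1, h2, Pi.smul_apply, smul_eq_mul]
    rw [e, map_smul, ← hf]
  have hae : (f : ℝ → ℝ) =ᵐ[volume] green m fun x => E * f x := by
    have h1 := (hm.memLp_green mg).coeFn_toLp
    rw [← hm.greenOp_toLp mg, ← hfe] at h1
    exact h1
  have mf' : MemLp (fun x => E * f (-x) - m x * f x) 2 volume :=
    ((memLp_comp_neg mf).const_mul E).sub (MemLp.bdd_continuous_mul hm.continuous hM mf)
  have hw : IsWeakDeriv f fun x => E * f (-x) - m x * f x := by
    refine (hm.isWeakDeriv_green mg).congr_ae hae.symm ?_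
    filter_upwards [hae] with x hx
    rw [← hx]
  have hw' := hw.comp_neg
  have mr' : MemLp (fun x => -(E * f (- -x) - m (-x) * f (-x))) 2 volume := (memLp_comp_neg mf').neg
  rw [mem_eigenspace_dirac_iff]
  refine ⟨_, (hasWeakDeriv_spinorField mf mf' hw ((1 / 2 : ℝ) • spinorR)).add
    (hasWeakDeriv_spinorField (memLp_comp_neg mf) mr' hw' ((s / 2) • (Complex.I • spinorL))), ?_⟩
  filter_upwards [coeFn_assemble s f, coeFn_spinorField_add mf' mr' s] with x h1 h2
  have h3 := diracExpr_eq m _ _ x _ _ _ _ h1 h2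
  refine Eq.trans ?_ h3.symm
  rw [h1, Complex.coe_smul, hm.even, neg_neg, smul_add, smul_smul, smul_smul]
  congr 2
  · ring
  · linear_combination (E * f (-x) / 2) * hs

lemma HasWeakDeriv.isWeakDeriv_comp {α g : H} (h : HasWeakDeriv α g) (L : Spinor →L[ℝ] ℝ) :
    IsWeakDeriv (fun x => L (α x)) fun x => L (g x) := by
  intro φ h1 h2
  have cd : Continuous (deriv φ) := h1.continuous_deriv (by simp)
  have key : ∀ ψ : ℝ → ℝ, Continuous ψ → HasCompactSupport ψ → ∀ u : H,
      ∫ x, ψ x * L (u x) = L (∫ x, ψ x • u x) := by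
    intro ψ c1 c2 u
    rw [← L.integral_comp_comm (integrable_smul_of_test c1 c2 u)]
    simp only [map_smul, smul_eq_mul]
  rw [key _ cd h2.deriv, key _ h1.continuous h2, h φ h1 h2, map_neg]

/-- A real part, selected by `ρ`, of the combination of components of a spinor field on which the
Dirac operator with even mass acts as a scalar operator. -/
def scalarPart (ρ : ℂ →ₗ[ℝ] ℝ) (s : ℝ) (α : H) (x : ℝ) : ℝ :=
  ρ (coordR (α x)) + s * ρ (coordL (α (-x)))

lemma memLp_linear_comp (L : Spinor →ₗ[ℝ] ℝ) (α : H) : MemLp (fun x => L (α x)) 2 volume :=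
  (LinearMap.toContinuousLinearMap L).comp_memLp' (Lp.memLp α)

lemma memLp_scalarPart (ρ : ℂ →ₗ[ℝ] ℝ) (s : ℝ) (α : H) :
    MemLp (scalarPart ρ s α) 2 volume :=
  (memLp_linear_comp (ρ.comp coordR) α).add
    ((memLp_comp_neg (memLp_linear_comp (ρ.comp coordL) α)).const_mul s)

/-- Adding to one equation of the eigenvalue system s times the reflection of the other closes the
system on a single function. As E and m are real, real and imaginary parts may be taken separately;
uniqueness of the L² solution then turns the differential equation into the integral equation. -/
lemma scalarPart_eigen (hm : IsConfining m) (hM : ∀ x, |m x| ≤ M) {E s : ℝ} (hs : s ^ 2 = 1)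
    {α : H} (hα : α ∈ eigenspace (dirac m) (E : ℂ)) (ρ : ℂ →ₗ[ℝ] ℝ) :
    ((memLp_scalarPart ρ s α).toLp _ : RealL2)
      = (s * E) • hm.greenOp ((memLp_scalarPart ρ s α).toLp _) := by
  obtain ⟨g, hg, hE⟩ := (mem_eigenspace_dirac_iff _ _ _).1 hα
  have mP := memLp_scalarPart ρ s α
  have mR := memLp_linear_comp (ρ.comp coordR)
  have mL := memLp_linear_comp (ρ.comp coordL)
  have wR := hg.isWeakDeriv_comp (LinearMap.toContinuousLinearMap (ρ.comp coordR))
  have wL := (hg.isWeakDeriv_comp (LinearMap.toContinuousLinearMap (ρ.comp coordL))).comp_neg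
  have hw := wR.add (wL.const_mul s) (mR α) (mR g) ((memLp_comp_neg (mL α)).const_mul s)
    ((memLp_comp_neg (mL g)).neg.const_mul s)
  have hpt : ∀ᵐ x, ρ (coordR (g x)) = E * ρ (coordL (α x)) - m x * ρ (coordR (α x)) ∧
      ρ (coordL (g x)) = m x * ρ (coordL (α x)) - E * ρ (coordR (α x)) := by
    filter_upwards [hE] with x hx
    rw [Complex.coe_smul] at hx
    have h1 := congrArg (fun z => ρ (coordR z)) hx
    have h2 := congrArg (fun z => ρ (coordL z)) hx
    simp only [map_smul, coordR_diracExpr, coordL_diracExpr, map_neg, map_add, map_sub,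
      ← Complex.real_smul, smul_eq_mul] at h1 h2
    constructor <;> linarith
  have hw' : IsWeakDeriv (scalarPart ρ s α)
      fun x => s * E * scalarPart ρ s α (-x) - m x * scalarPart ρ s α x := by
    refine hw.congr_ae (Filter.EventuallyEq.refl _ _) ?_
    filter_upwards [hpt, ae_comp_neg hpt] with x h1 h2
    simp only [LinearMap.coe_toContinuousLinearMap', LinearMap.comp_apply, scalarPart, neg_neg]
    rw [h1.1, h2.2, hm.even]
    linear_combination (-E * ρ (coordL (α x))) * hs
  have hP := hm.ae_eq_green hM mP (mP.const_mul (s * E)) hw'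
  rw [← map_smul, ← MemLp.toLp_const_smul, hm.greenOp_toLp (mP.const_smul (s * E)),
    MemLp.toLp_eq_toLp_iff]
  exact hP

/-- The parts of both parities determine the two components of α; when one parity vanishes, the
component along i(1, -i) is s times the reflection of the other. -/
lemma eq_smul_assemble {s : ℝ} (hs : s ^ 2 = 1) {α : H} {f : RealL2} {a b : ℝ}
    (h₁ : ((memLp_scalarPart Complex.reLm s α).toLp _ : RealL2) = a • f)
    (h₂ : ((memLp_scalarPart Complex.imLm s α).toLp _ : RealL2) = b • f)
    (h₃ : ((memLp_scalarPart Complex.reLm (-s) α).toLp _ : RealL2) = 0)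
    (h₄ : ((memLp_scalarPart Complex.imLm (-s) α).toLp _ : RealL2) = 0) :
    α = (⟨a, b⟩ : ℂ) • assemble s f := by
  have key : ∀ (ρ : ℂ →ₗ[ℝ] ℝ) (c : ℝ), ((memLp_scalarPart ρ s α).toLp _ : RealL2) = c • f →
      ((memLp_scalarPart ρ (-s) α).toLp _ : RealL2) = 0 →
      ∀ᵐ x, ρ (coordR (α x)) = c * f x / 2 ∧ ρ (coordL (α x)) = s * (c * f (-x)) / 2 := by
    intro ρ c h h0
    have e1 : ∀ᵐ x, scalarPart ρ s α x = c * f x := by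
      have := (memLp_scalarPart ρ s α).coeFn_toLp
      rw [h] at this
      filter_upwards [this, Lp.coeFn_smul c f] with x k1 k2
      rw [← k1, k2, Pi.smul_apply, smul_eq_mul]
    have e2 : ∀ᵐ x, scalarPart ρ (-s) α x = 0 := by
      have := (memLp_scalarPart ρ (-s) α).coeFn_toLp
      rw [h0] at this
      filter_upwards [this, Lp.coeFn_zero ℝ 2 (volume : Measure ℝ)] with x k1 k2
      rw [← k1, k2, Pi.zero_apply]
    filter_upwards [e1, e2, ae_comp_neg e1, ae_comp_neg e2] with x k1 k2 k3 k4
    simp only [scalarPart, neg_neg] at k1 k2 k3 k4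
    refine ⟨by linarith, ?_⟩
    linear_combination (-ρ (coordL (α x))) * hs + s / 2 * k3 - s / 2 * k4
  refine Lp.ext ?_
  filter_upwards [key _ _ h₁ h₃, key _ _ h₂ h₄, coeFn_assemble s f,
    Lp.coeFn_smul (⟨a, b⟩ : ℂ) (assemble s f)] with x k1 k2 k3 k4
  simp only [Complex.reLm_coe, Complex.imLm_coe] at k1 k2
  have eR : coordR (α x) = (⟨a, b⟩ : ℂ) * (f x / 2 : ℝ) := by
    apply Complex.ext
    · rw [k1.1]; simp; ring
    · rw [k2.1]; simp; ring
  have eL : coordL (α x) = (⟨a, b⟩ : ℂ) * (s * f (-x) / 2 : ℝ) := by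
    apply Complex.ext
    · rw [k1.2]; simp; ring
    · rw [k2.2]; simp; ring
  rw [k4, Pi.smul_apply, k3, coord_expansion (α x), eR, eL, smul_add, mul_smul, mul_smul,
    Complex.coe_smul, Complex.coe_smul]

/-- Eigenfunctions of the Dirac operator come from eigenfunctions of the scalar operator. -/
lemma eigenspace_dirac_classification (hm : IsConfining m) (hM : ∀ x, |m x| ≤ M) {K E₀ : ℝ}
    {f : RealL2} (huniq : ∀ (E' : ℝ) (g : RealL2), |E'| ≤ K →
      g = E' • hm.greenOp g → (∃ c : ℝ, g = c • f) ∧ (g ≠ 0 → E' = E₀))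
    {E s : ℝ} (hE : |E| ≤ K) (hs : s ^ 2 = 1) (hne : -s * E ≠ E₀) {α : H}
    (hα : α ∈ eigenspace (dirac m) (E : ℂ)) :
    (∃ c : ℂ, α = c • assemble s f) ∧ (s * E ≠ E₀ → α = 0) := by
  have hsa : |s| = 1 := by rw [← sq_abs] at hs; exact (pow_eq_one_iff_of_nonneg (abs_nonneg _) two_ne_zero).1 hs
  have hs' : (-s) ^ 2 = 1 := by rw [neg_sq, hs]
  have hb : |s * E| ≤ K := by rwa [abs_mul, hsa, one_mul]
  have hb' : |-s * E| ≤ K := by rwa [neg_mul, abs_neg]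
  -- The part of opposite parity would be a scalar eigenfunction for -sE, which differs from the
  -- only admissible value E₀.
  have hz : ∀ ρ : ℂ →ₗ[ℝ] ℝ, ((memLp_scalarPart ρ (-s) α).toLp _ : RealL2) = 0 := by
    intro ρ
    by_contra h
    exact hne ((huniq _ _ hb' (scalarPart_eigen hm hM hs' hα ρ)).2 h)
  have hc := fun ρ => huniq _ _ hb (scalarPart_eigen hm hM hs hα ρ)
  constructor
  · obtain ⟨a, ha⟩ := (hc Complex.reLm).1
    obtain ⟨b, hb⟩ := (hc Complex.imLm).1
    exact ⟨_, eq_smul_assemble hs ha hb (hz _) (hz _)⟩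
  · intro hne'
    have hz' : ∀ ρ : ℂ →ₗ[ℝ] ℝ, ((memLp_scalarPart ρ s α).toLp _ : RealL2) = (0 : ℝ) • f := by
      intro ρ
      rw [zero_smul]
      by_contra h
      exact hne' ((hc ρ).2 h)
    rw [eq_smul_assemble hs (hz' _) (hz' _) (hz _) (hz _)]
    exact zero_smul ℂ _

end Transfer

/-! ### Comparison with the zero modes, simplicity and counting -/

variable {κ : ℝ → ℝ} {κinf : ℝ}

/-- Conjugation turns (1, i) into (1, -i), and evenness of the profile makes the left mode the
reflection of the right one; so `assemble` of the shifted profile is the expected combination of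
zero modes. -/
lemma IsDomainWall.zeroModeL_eq (hκ : IsDomainWall κ κinf) (δ x : ℝ) :
    zeroModeL κ δ x = (profile κ (-x - δ) / √2) • spinorL := by
  have e : profile κ (-x - δ) = profile κ (x + δ) := by
    rw [← hκ.profile_neg]; congr 1; ring
  rw [e, zeroModeL, zeroMode_eq]
  ext i
  fin_cases i <;> simp [spinorR, spinorL]

lemma IsDomainWall.coeFn_assemble_profile (hκ : IsDomainWall κ κinf) (δ s : ℝ) :
    ∀ᵐ x, assemble s ((hκ.memLp_profile_shift δ).toLp _) x
      = ((1 / √2 : ℝ) : ℂ) • (zeroModeR κ δ x + s • (Complex.I • zeroModeL κ δ x)) := by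
  have h := (hκ.memLp_profile_shift δ).coeFn_toLp
  filter_upwards [coeFn_assemble s ((hκ.memLp_profile_shift δ).toLp _), h, ae_comp_neg h]
    with x h1 h2 h3
  have h4 : (1 / √2) * (1 / √2) = 1 / 2 := by
    rw [div_mul_div_comm, Real.mul_self_sqrt (by norm_num), one_mul]
  rw [h1, h2, h3, zeroModeR, zeroMode_eq, hκ.zeroModeL_eq, smul_comm Complex.I, Complex.coe_smul,
    smul_add, smul_smul, smul_smul, smul_smul]
  congr 2
  · linear_combination (-profile κ (x - δ)) * h4
  · linear_combination (-s * profile κ (-x - δ)) * h4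

lemma IsDomainWall.eLpNorm_assemble_sub_le (hκ : IsDomainWall κ κinf) (δ : ℝ) {s b : ℝ}
    (hs : s ^ 2 = 1) {f : RealL2} (hf : ‖f - (hκ.memLp_profile_shift δ).toLp _‖ ≤ b) :
    eLpNorm (fun x => assemble s f x - ((1 / √2 : ℝ) : ℂ) •
      (zeroModeR κ δ x + s • (Complex.I • zeroModeL κ δ x))) 2 volume ≤ ENNReal.ofReal b := by
  set p : RealL2 := (hκ.memLp_profile_shift δ).toLp _ with hp
  have e : eLpNorm (fun x => assemble s f x - ((1 / √2 : ℝ) : ℂ) •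
      (zeroModeR κ δ x + s • (Complex.I • zeroModeL κ δ x))) 2 volume
      = eLpNorm (assemble s f - assemble s p : H) 2 volume := by
    refine eLpNorm_congr_ae ?_
    filter_upwards [hκ.coeFn_assemble_profile δ s, Lp.coeFn_sub (assemble s f) (assemble s p)]
      with x h1 h2
    rw [h2, Pi.sub_apply, hp, h1]
  rw [e, ← ENNReal.ofReal_toReal (Lp.eLpNorm_ne_top _), ← Lp.norm_def, ← assemble_sub,
    norm_assemble hs]
  exact ENNReal.ofReal_le_ofReal hf

section Simple

variable {m : ℝ → ℝ} {M : ℝ}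

lemma isSimpleEigenvalue_dirac (hm : IsConfining m) (hM : ∀ x, |m x| ≤ M) {K E₀ : ℝ}
    {f : RealL2} (hf : f = E₀ • hm.greenOp f) (hf1 : ‖f‖ = 1) (hE₀ : |E₀| ≤ K)
    (huniq : ∀ (E' : ℝ) (g : RealL2), |E'| ≤ K → g = E' • hm.greenOp g →
      (∃ c : ℝ, g = c • f) ∧ (g ≠ 0 → E' = E₀)) {s : ℝ} (hs : s ^ 2 = 1) :
    IsSimpleEigenvalue (dirac m) ((s * E₀ : ℝ) : ℂ) := by
  have hE0 : E₀ ≠ 0 := by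
    rintro rfl
    rw [zero_smul] at hf
    rw [hf, norm_zero] at hf1
    exact zero_ne_one hf1
  have hsa : |s| = 1 := by
    rw [← sq_abs] at hs
    exact (pow_eq_one_iff_of_nonneg (abs_nonneg _) two_ne_zero).1 hs
  have hmem := assemble_mem_eigenspace hm hM hs hf
  refine finrank_eq_one (⟨assemble s f, hmem⟩ : eigenspace (dirac m) ((s * E₀ : ℝ) : ℂ)) ?_ ?_
  · intro h
    have h0 : assemble s f = 0 := congrArg Subtype.val h
    rw [← norm_assemble hs, h0, norm_zero] at hf1
    exact zero_ne_one hf1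
  · rintro ⟨α, hα⟩
    -- Since s² = 1 this says -E₀ ≠ E₀: the nonzero value of E₀ separates the two parities and makes
    -- each eigenvalue simple.
    have hne : -s * (s * E₀) ≠ E₀ := by
      intro h
      apply hE0
      linear_combination (-1 / 2) * h - E₀ / 2 * hs
    obtain ⟨c, hc⟩ := (eigenspace_dirac_classification hm hM huniq
      (by rwa [abs_mul, hsa, one_mul]) hs hne hα).1
    exact ⟨c, Subtype.ext hc.symm⟩

lemma eq_or_eq_of_isEigenvalue_dirac (hm : IsConfining m) (hM : ∀ x, |m x| ≤ M) {K E₀ : ℝ}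
    {f : RealL2} (huniq : ∀ (E' : ℝ) (g : RealL2), |E'| ≤ K → g = E' • hm.greenOp g →
      (∃ c : ℝ, g = c • f) ∧ (g ≠ 0 → E' = E₀)) {E : ℝ} (hE : |E| ≤ K)
    (hEig : IsEigenvalue (dirac m) (E : ℂ)) : E = E₀ ∨ E = -E₀ := by
  by_contra! h
  refine hEig ((Submodule.eq_bot_iff _).2 fun α hα => ?_)
  refine (eigenspace_dirac_classification hm hM huniq hE (s := 1) (by norm_num) ?_ hα).2 ?_
  · intro h'
    exact h.2 (by linarith)
  · rw [one_mul]
    exact h.1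

lemma IsSimpleEigenvalue.isEigenvalue {T : H →ₗ.[ℂ] H} {E : ℂ} (h : IsSimpleEigenvalue T E) :
    IsEigenvalue T E := by
  intro h0
  rw [IsSimpleEigenvalue, h0, finrank_bot] at h
  exact zero_ne_one h

end Simple

end DomainWall

end

theorem theorem2 (κ : ℝ → ℝ) (κinf : ℝ) (hκ : DomainWall.IsDomainWall κ κinf)
    (hgap : DomainWall.SpectralGap κ κinf) (K : ℝ) (hK0 : 0 < K) (hK : K < κinf) :
    ∃ δ₀ C : ℝ, 1 ≤ δ₀ ∧ 0 < C ∧ ∀ δ : ℝ, δ₀ < δ →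
      ∃ (Ep Em : ℝ) (αp αm : DomainWall.H),
        Em ≠ Ep ∧
        {E : ℝ | E ∈ Set.Icc (-K) K ∧
          DomainWall.IsEigenvalue (DomainWall.dirac (DomainWall.twoWall κ δ)) (E : ℂ)} = {Ep, Em} ∧
        DomainWall.IsSimpleEigenvalue (DomainWall.dirac (DomainWall.twoWall κ δ)) (Ep : ℂ) ∧
        DomainWall.IsSimpleEigenvalue (DomainWall.dirac (DomainWall.twoWall κ δ)) (Em : ℂ) ∧
        |Ep - 2 * DomainWall.gammaConst κ ^ 2 * Real.exp (-(2 * ∫ y in (0 : ℝ)..δ, κ y))|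
          ≤ C * Real.exp (-(4 * κinf * δ)) ∧
        |Em - -(2 * DomainWall.gammaConst κ ^ 2 * Real.exp (-(2 * ∫ y in (0 : ℝ)..δ, κ y)))|
          ≤ C * Real.exp (-(4 * κinf * δ)) ∧
        ‖αp‖ = 1 ∧
        αp ∈ DomainWall.eigenspace (DomainWall.dirac (DomainWall.twoWall κ δ)) (Ep : ℂ) ∧
        MeasureTheory.eLpNorm (fun x => αp x - ((1 / √2 : ℝ) : ℂ) •
            (DomainWall.zeroModeR κ δ x + Complex.I • DomainWall.zeroModeL κ δ x)) 2
            MeasureTheory.volume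
          ≤ ENNReal.ofReal (C * Real.exp (-(2 * κinf * δ))) ∧
        ‖αm‖ = 1 ∧
        αm ∈ DomainWall.eigenspace (DomainWall.dirac (DomainWall.twoWall κ δ)) (Em : ℂ) ∧
        MeasureTheory.eLpNorm (fun x => αm x - ((1 / √2 : ℝ) : ℂ) •
            (DomainWall.zeroModeR κ δ x - Complex.I • DomainWall.zeroModeL κ δ x)) 2
            MeasureTheory.volume
          ≤ ENNReal.ofReal (C * Real.exp (-(2 * κinf * δ))) := by
  obtain ⟨C, hC, hev⟩ := hgap.exists_scalar_eigenvector hκ hK0 hK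
  obtain ⟨N, hN⟩ := Filter.eventually_atTop.1 hev
  obtain ⟨M, hM⟩ := hκ.exists_abs_le
  -- Both N and C come from the scalar problem, before δ is chosen; the passage to spinors is
  -- isometric and costs no constant.
  refine ⟨max 1 N, C, le_max_left _ _, hC, fun δ hδ => ?_⟩
  obtain ⟨E, f, hf, hf1, hfp, hE, hEK, huniq⟩ := hN δ ((le_max_right _ _).trans hδ.le)
  have hm := hκ.isConfining_twoWall δ
  have hMδ := DomainWall.IsDomainWall.abs_twoWall_le hM δ
  have h1 : (1 : ℝ) ^ 2 = 1 := by norm_num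
  have h2 : (-1 : ℝ) ^ 2 = 1 := by norm_num
  have hE0 : E ≠ 0 := by
    rintro rfl
    rw [zero_smul] at hf
    rw [hf, norm_zero] at hf1
    exact zero_ne_one hf1
  have sp := DomainWall.isSimpleEigenvalue_dirac hm hMδ hf hf1 hEK huniq h1
  have sm := DomainWall.isSimpleEigenvalue_dirac hm hMδ hf hf1 hEK huniq h2
  have mp := DomainWall.assemble_mem_eigenspace hm hMδ h1 hf
  have mm := DomainWall.assemble_mem_eigenspace hm hMδ h2 hf
  have np := hκ.eLpNorm_assemble_sub_le δ h1 hfp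
  have nm := hκ.eLpNorm_assemble_sub_le δ h2 hfp
  simp only [one_mul, neg_one_mul, one_smul, neg_smul, ← sub_eq_add_neg] at sp sm mp mm np nm
  refine ⟨E, -E, DomainWall.assemble 1 f, DomainWall.assemble (-1) f, ?_, ?_, sp, sm, hE, ?_, ?_,
    mp, np, ?_, mm, nm⟩
  · intro h
    exact hE0 (by linarith)
  · ext E'
    simp only [Set.mem_ofPred_eq, Set.mem_insert_iff, Set.mem_singleton_iff, Set.mem_Icc, ← abs_le]
    constructor
    · rintro ⟨hK', hEig⟩
      exact DomainWall.eq_or_eq_of_isEigenvalue_dirac hm hMδ huniq hK' hEig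
    · rintro (rfl | rfl)
      · exact ⟨hEK, sp.isEigenvalue⟩
      · exact ⟨by rwa [abs_neg], sm.isEigenvalue⟩
  · rw [← abs_neg]
    refine le_of_eq_of_le ?_ hE
    congr 1
    ring
  · rw [DomainWall.norm_assemble h1, hf1]
  · rw [DomainWall.norm_assemble h2, hf1]
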